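/- Let $k$ be an algebraically closed field and let $A=\bigoplus_{i\ge 0}A_i$ be a finite dimensional, non-negatively graded $k$-algebra. Let $\Lambda$ be a partially ordered set indexing the isomorphism classes of irreducible $A_0$-modules $L(\lambda)$ (equivalently, of irreducible $A$-modules, $A$ acting on $L(\lambda)$ through the projection $\pi\colon A\to A/\bigoplus_{i>0}A_i\cong A_0$). For $B=A$ or $B=A_0$ and $\lambda\in\Lambda$, let the standard module of $B$ at $\lambda$ be the largest quotient of the projective cover $P(\lambda)$ of $L(\lambda)$, and the costandard module the largest submodule of the injective hull of $L(\lambda)$, all of whose composition factors are of the form $L(\mu)$ with $\mu\le\lambda$. The algebra $B$ is quasi-hereditary with weight poset $\Lambda$ if, for every $\lambda$, $L(\lambda)$ has multiplicity one in the standard module at $\lambda$, and the kernel of the map from $P(\lambda)$ to the standard module at $\lambda$ has a finite filtration whose sections are standard modules at weights $\mu>\lambda$. Write $\Delta(\lambda)$ for the standard modules of $A$, and $\Delta^0(\lambda)$, $\nabla_0(\lambda)$ for the standard and costandard modules of $A_0$. The module $\Delta(\lambda)=\bigoplus_{s\ge 0}\Delta(\lambda)_s$ is graded as a quotient of $P(\lambda)=Ae_\lambda$,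 where $e_\lambda\in A_0$ is a primitive idempotent with $e_\lambda L(\lambda)\neq 0$; each $\Delta(\lambda)_s$ is an $A_0$-module. An $A_0$-module has a $\Delta^0$-filtration if it has a finite filtration by submodules whose sections are isomorphic to modules $\Delta^0(\mu)$, $\mu\in\Lambda$. Let $\mathrm{ext}^\bullet_A$ be the Ext-functor in the category of $\mathbb Z$-graded $A$-modules, let $M\langle j\rangle_i=M_{i-j}$, and regard $A_0$-modules, through $\pi$, as graded $A$-modules concentrated in grade $0$. For $m\ge 0$, $A$ is called $m$-Q-Koszul if $A_0$ is quasi-hereditary with weight poset $\Lambda$ and, for all $\lambda,\mu\in\Lambda$, all integers $j$ and all $0<i\le m$, $\mathrm{ext}^i_A(\Delta^0(\lambda),\nabla_0(\mu)\langle j\rangle)\neq 0$ implies $i=j$. For an $A_0$-module $V$ with minimal projective resolution $\cdots\to P^1\to P^0\to V\to 0$, put $\Omega_0(V)=V$ and, for $m>0$, $\Omega_m(V)=\ker(P^{m-1}\to P^{m-2})$, where $P^{-1}=V$. Assume that $A$ is quasi-hereditary with weight poset $\Lambda$. (a) If $A$ is 2-Q-Koszul, then $\Delta(\gamma)_1$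 has a $\Delta^0$-filtration for every $\gamma\in\Lambda$. (b) If $A$ is 3-Q-Koszul, then $\mathrm{Ext}^r_{A_0}(\Delta(\gamma)_2,\nabla_0(\nu))=0$ for all $r\ge 2$ and all $\gamma,\nu\in\Lambda$. (c) More generally, suppose that $A$ is $(n+1)$-Q-Koszul for some integer $n>0$, and let $s$ be an integer with $0<s\le n$. Then $\mathrm{Ext}^r_{A_0}(\Delta(\gamma)_s,\nabla_0(\nu))=0$ for all $r\ge s$ and all $\gamma,\nu\in\Lambda$. In addition, for every $\gamma\in\Lambda$, the syzygy modules $\Omega_{s-1}(\Delta(\gamma)_s),\ \Omega_s(\Delta(\gamma)_s),\ \Omega_{s+1}(\Delta(\gamma)_s),\ \dots$ all have $\Delta^0$-filtrations. -/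

import Mathlib

universe u v

namespace QKoszul

/-! ### Quasi-hereditary algebras -/

section QuasiHereditary

variable (k : Type u) {B : Type u} [Field k] [Ring B] [Algebra k B] {Λ : Type v} [PartialOrder Λ]

/-- Primitive idempotents: nonzero idempotents that are not the sum of two nonzero orthogonal
idempotents. -/
def IsPrimitiveIdempotent (e : B) : Prop :=
  IsIdempotentElem e ∧ e ≠ 0 ∧
    ∀ f g : B, IsIdempotentElem f → IsIdempotentElem g → f * g = 0 → g * f = 0 → f + g = e →
      f = 0 ∨ g = 0

/-- `e : Λ → B` is a complete irredundant family of primitive idempotents: every irreducible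
left `B`-module `S` satisfies `e λ S ≠ 0` for exactly one `λ`. Equivalently, with `L(λ)` the head
of the indecomposable projective module `B e_λ`, the `L(λ)` (`λ ∈ Λ`) represent the distinct
isomorphism classes of irreducible `B`-modules, and `B e_λ` is the projective cover `P(λ)` of
`L(λ)`. -/
structure IsWeightSystem (e : Λ → B) : Prop where
  primitive : ∀ l, IsPrimitiveIdempotent (e l)
  complete : ∀ S : ModuleCat.{u} B, IsSimpleModule B S → ∃! l, ∃ x : S, e l • x ≠ 0

/-- The smallest submodule of `M` such that all composition factors of the quotient are of the
form `L(μ)` with `μ ≤ l` (note that `L(μ)` is a composition factor of a `B`-module `N` iff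
`e μ N ≠ 0`). -/
def truncKer (e : Λ → B) (l : Λ) (M : Type u) [AddCommGroup M] [Module B M] : Submodule B M :=
  Submodule.span B {x | ∃ m, ¬ m ≤ l ∧ ∃ y : M, x = e m • y}

/-- The largest submodule of `M` all of whose composition factors are of the form `L(μ)` with
`μ ≤ l`. -/
def truncSub (e : Λ → B) (l : Λ) (M : Type u) [AddCommGroup M] [Module B M] : Submodule B M where
  carrier := {x | ∀ m, ¬ m ≤ l → ∀ b : B, e m • b • x = 0}
  zero_mem' := by intro m _ b; simp
  add_mem' := by
    intro x y hx hy m hm b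
    rw [smul_add, smul_add, hx m hm b, hy m hm b, add_zero]
  smul_mem' := by
    intro c x hx m hm b
    rw [smul_smul b c x]
    exact hx m hm (b * c)

/-- The projective cover `P(l) = B e_l` of `L(l)`. -/
abbrev projCover (e : Λ → B) (l : Λ) : Submodule B B := Submodule.span B {e l}

/-- The standard module `Δ(l)`: the largest quotient of `P(l)` all of whose composition factors
are of the form `L(μ)` with `μ ≤ l`. -/
abbrev Std (e : Λ → B) (l : Λ) : Type u :=
  (projCover e l) ⧸ truncKer e l (projCover e l)

/-- The linear dual of the right regular `B`-module. -/
def Coreg (k B : Type u) [Field k] [Ring B] [Algebra k B] : Type u := Module.Dual k B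

instance : AddCommGroup (Coreg k B) := inferInstanceAs (AddCommGroup (Module.Dual k B))

instance : FunLike (Coreg k B) B k := inferInstanceAs (FunLike (Module.Dual k B) B k)

/-- The left action of `B` on the dual of the right regular module: `(b f)(x) = f (x b)`. -/
instance : Module B (Coreg k B) where
  smul b f := LinearMap.comp (show Module.Dual k B from f) (LinearMap.mulRight k b)
  one_smul f := by
    apply LinearMap.ext; intro x
    change (show Module.Dual k B from f) (x * 1) = _
    rw [mul_one]
  mul_smul b c f := by
    apply LinearMap.ext; intro x
    change (show Module.Dual k B from f) (x * (b * c)) =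
      (show Module.Dual k B from f) (x * b * c)
    rw [mul_assoc]
  smul_zero b := by
    apply LinearMap.ext; intro x; rfl
  smul_add b f g := by
    apply LinearMap.ext; intro x; rfl
  add_smul b c f := by
    apply LinearMap.ext; intro x
    change (show Module.Dual k B from f) (x * (b + c)) =
      (show Module.Dual k B from f) (x * b) + (show Module.Dual k B from f) (x * c)
    rw [mul_add, map_add]
  zero_smul f := by
    apply LinearMap.ext; intro x
    change (show Module.Dual k B from f) (x * 0) = 0
    rw [mul_zero, map_zero]

theorem Coreg.smul_apply (b : B) (f : Coreg k B) (x : B) : (b • f) x = f (x * b) := rfl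

theorem Coreg.add_apply (f g : Coreg k B) (x : B) : (f + g) x = f x + g x := rfl

/-- The injective hull `I(l) = Hom_k(e_l B, k)` of `L(l)`, realized as the set of the linear forms
`f` on `B` with `f x = f (e_l x)` for all `x`. -/
def injHull (e : Λ → B) (l : Λ) : Submodule B (Coreg k B) where
  carrier := {f | ∀ x, f x = f (e l * x)}
  zero_mem' := by intro x; rfl
  add_mem' := by
    intro f g hf hg x
    rw [Coreg.add_apply, Coreg.add_apply, hf x, hg x]
  smul_mem' := by
    intro b f hf x
    rw [Coreg.smul_apply, Coreg.smul_apply, hf (x * b), mul_assoc]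

/-- The costandard module `∇(l)`: the largest submodule of `I(l)` all of whose composition
factors are of the form `L(μ)` with `μ ≤ l`. -/
abbrev Costd (e : Λ → B) (l : Λ) : Type u := truncSub e l (injHull k e l)

/-- `M` has a finite filtration by submodules whose sections are isomorphic to standard modules
`Δ(μ)` with `μ ∈ Γ`. -/
def HasStdFiltrationOn (e : Λ → B) (Γ : Set Λ) (M : Type u) [AddCommGroup M] [Module B M] :
    Prop :=
  ∃ (t : ℕ) (F : ℕ → Submodule B M), Monotone F ∧ F 0 = ⊥ ∧ F t = ⊤ ∧
    ∀ i < t, ∃ m ∈ Γ, Nonempty ((F (i + 1) ⧸ (F i).submoduleOf (F (i + 1))) ≃ₗ[B] Std e m)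

/-- `M` has a `Δ`-filtration. -/
def HasStdFiltration (e : Λ → B) (M : Type u) [AddCommGroup M] [Module B M] : Prop :=
  HasStdFiltrationOn e Set.univ M

/-- The algebra `B` is quasi-hereditary with weight poset `Λ` (the irreducible modules being
labelled through `e`): `L(l)` has multiplicity `dim_k e_l Δ(l) = 1` in `Δ(l)`, and the kernel of
`P(l) → Δ(l)` has a filtration with sections `Δ(μ)`, `μ > l`. -/
structure IsQuasiHereditary (e : Λ → B) : Prop where
  weights : IsWeightSystem e
  mult_one : ∀ l,
    Module.finrank k (LinearMap.range (Algebra.lsmul k k (Std e l) (e l))) = 1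
  filtration : ∀ l, HasStdFiltrationOn e {m | l < m} (truncKer e l (projCover e l))

end QuasiHereditary

/-! ### Minimal projective resolutions and syzygies -/

section Syzygies

variable {R : Type u} [Ring R]

/-- A submodule `N` of `M` is superfluous if `N + U = M` only for `U = M`. -/
def IsSuperfluous {M : Type u} [AddCommGroup M] [Module R M] (N : Submodule R M) : Prop :=
  ∀ U : Submodule R M, N ⊔ U = ⊤ → U = ⊤

/-- A minimal projective resolution `⋯ → P 1 → P 0 → V → 0`: every map `P n → im` is a projective
cover of its image. -/
structure MinProjRes (V : Type u) [AddCommGroup V] [Module R V] where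
  P : ℕ → ModuleCat.{u} R
  projective : ∀ n, Module.Projective R (P n)
  aug : P 0 →ₗ[R] V
  d : ∀ n, P (n + 1) →ₗ[R] P n
  aug_surjective : Function.Surjective aug
  exact_zero : Function.Exact (d 0) aug
  exact_succ : ∀ n, Function.Exact (d (n + 1)) (d n)
  minimal_zero : IsSuperfluous (LinearMap.ker aug)
  minimal_succ : ∀ n, IsSuperfluous (LinearMap.ker (d n))

/-- The `m`th syzygy `Ω_m(V)`: `Ω_0(V) = V`, and `Ω_m(V)` is the kernel of `P (m-1) → P (m-2)`
for `m > 0`, with `P (-1) = V`. -/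
def MinProjRes.syzygy {V : Type u} [AddCommGroup V] [Module R V] (Q : MinProjRes (R := R) V) :
    ℕ → ModuleCat.{u} R
  | 0 => ModuleCat.of R V
  | 1 => ModuleCat.of R (LinearMap.ker Q.aug)
  | m + 2 => ModuleCat.of R (LinearMap.ker (Q.d m))

end Syzygies

/-! ### Graded modules -/

section Graded

variable {k A : Type u} [Field k] [Ring A] [Algebra k A]

/-- The subalgebra `A_0`. -/
abbrev GrZero (𝒜 : ℕ → Submodule k A) [GradedAlgebra 𝒜] : Type u :=
  ↥(SetLike.GradeZero.subalgebra 𝒜)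

/-- The projection `π : A → A_0` with kernel `A_{≥ 1}`. -/
def projZero (𝒜 : ℕ → Submodule k A) [GradedAlgebra 𝒜] : A →+* GrZero 𝒜 :=
  (GradedRing.projZeroRingHom 𝒜).codRestrict (SetLike.GradeZero.subalgebra 𝒜)
    (fun x => (GradedRing.projZeroRingHom' 𝒜 x).2)

/-- `ℤ`-graded left `A`-modules `M = ⨁ M_j`, with `A_i M_j ⊆ M_{i+j}`. -/
structure GrMod (𝒜 : ℕ → Submodule k A) where
  carrier : Type u
  [addCommGroup : AddCommGroup carrier]
  [module : Module A carrier]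
  deg : ℤ → AddSubgroup carrier
  indep : iSupIndep deg
  iSup_eq_top : iSup deg = ⊤
  smul_mem : ∀ (i : ℕ) (j : ℤ) (a : A) (x : carrier),
    a ∈ 𝒜 i → x ∈ deg j → a • x ∈ deg (i + j)

attribute [instance] GrMod.addCommGroup GrMod.module

/-- The shift `M⟨r⟩`, with `M⟨r⟩_i = M_{i-r}`. -/
def GrMod.shift {𝒜 : ℕ → Submodule k A} (M : GrMod 𝒜) (r : ℤ) : GrMod 𝒜 where
  carrier := M.carrier
  deg i := M.deg (i - r)
  indep := M.indep.comp (f := fun i : ℤ => i - r) sub_left_injective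
  iSup_eq_top := by
    rw [← M.iSup_eq_top]
    exact (Equiv.subRight r).iSup_comp (g := M.deg)
  smul_mem i j a x ha hx := by
    have := M.smul_mem i (j - r) a x ha hx
    rwa [← add_sub_assoc] at this

/-- The `A`-module obtained from the `A_0`-module `X` by restriction along `π : A → A_0`. -/
abbrev inflateModule (𝒜 : ℕ → Submodule k A) [GradedAlgebra 𝒜] (X : Type u) [AddCommGroup X]
    [Module (GrZero 𝒜) X] : Module A X :=
  Module.compHom X (projZero 𝒜)

theorem inflateModule_smul_eq_zero (𝒜 : ℕ → Submodule k A) [GradedAlgebra 𝒜] (X : Type u)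
    [AddCommGroup X] [Module (GrZero 𝒜) X] {i : ℕ} (hi : i ≠ 0) {a : A} (ha : a ∈ 𝒜 i) (x : X) :
    (inflateModule 𝒜 X).smul a x = 0 := by
  have h0 : projZero 𝒜 a = 0 := by
    apply Subtype.ext
    change GradedRing.projZeroRingHom 𝒜 a = 0
    rw [GradedRing.projZeroRingHom_apply]
    exact DirectSum.decompose_of_mem_ne 𝒜 ha hi
  change projZero 𝒜 a • x = 0
  rw [h0, zero_smul]

/-- The `A_0`-module `X`, regarded via `π` as a graded `A`-module concentrated in grade `0`. -/
def inflate (𝒜 : ℕ → Submodule k A) [GradedAlgebra 𝒜] (X : Type u) [AddCommGroup X]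
    [Module (GrZero 𝒜) X] : GrMod 𝒜 where
  carrier := X
  module := inflateModule 𝒜 X
  deg := fun i => if i = 0 then ⊤ else ⊥
  indep := by
    intro i
    by_cases hi : i = 0
    · have h : (⨆ j, ⨆ (_ : j ≠ i), (if j = 0 then (⊤ : AddSubgroup X) else ⊥)) = ⊥ := by
        refine iSup_eq_bot.2 fun j => iSup_eq_bot.2 fun hj => ?_
        rw [if_neg (fun h => hj (h.trans hi.symm))]
      exact disjoint_iff.2 (le_bot_iff.1 (inf_le_right.trans h.le))
    · simp only [if_neg hi]
      exact disjoint_bot_left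
  iSup_eq_top := by
    refine eq_top_iff.2 ?_
    exact le_trans (by simp) (le_iSup _ (0 : ℤ))
  smul_mem := by
    intro i j a x ha hx
    by_cases hj : j = 0
    · by_cases hi : i = 0
      · subst hi; subst hj; simp
      · have h : (inflateModule 𝒜 X).smul a x ∈
            (if (i : ℤ) + j = 0 then (⊤ : AddSubgroup X) else ⊥) := by
          rw [inflateModule_smul_eq_zero 𝒜 X hi ha x]
          exact zero_mem _
        exact h
    · rw [if_neg hj] at hx
      have h : (inflateModule 𝒜 X).smul a x ∈
          (if (i : ℤ) + j = 0 then (⊤ : AddSubgroup X) else ⊥) := by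
        have h0 : (inflateModule 𝒜 X).smul a (0 : X) = 0 := smul_zero (projZero 𝒜 a)
        rw [AddSubgroup.mem_bot.1 hx, h0]
        exact zero_mem _
      exact h

variable {𝒜 : ℕ → Submodule k A}

/-- The homomorphisms of graded modules, i.e. the grade preserving `A`-linear maps. -/
def grHom (M N : GrMod 𝒜) : AddSubgroup (M.carrier →ₗ[A] N.carrier) where
  carrier := {f | ∀ i, ∀ x ∈ M.deg i, f x ∈ N.deg i}
  zero_mem' := by intro i x _; exact zero_mem _
  add_mem' := by intro f g hf hg i x hx; exact add_mem (hf i x hx) (hg i x hx)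
  neg_mem' := by intro f hf i x hx; exact neg_mem (hf i x hx)

/-- Graded projective resolutions `⋯ → P 1 → P 0 → M → 0`. -/
structure GrProjRes (M : GrMod 𝒜) where
  P : ℕ → GrMod 𝒜
  projective : ∀ n, Module.Projective A (P n).carrier
  aug : (P 0).carrier →ₗ[A] M.carrier
  aug_mem : aug ∈ grHom (P 0) M
  d : ∀ n, (P (n + 1)).carrier →ₗ[A] (P n).carrier
  d_mem : ∀ n, d n ∈ grHom (P (n + 1)) (P n)
  aug_surjective : Function.Surjective aug
  exact_zero : Function.Exact (d 0) aug
  exact_succ : ∀ n, Function.Exact (d (n + 1)) (d n)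

/-- The `i`-cocycles of the complex `hom_A(P_•, N)`. -/
def GrProjRes.cocycles {M : GrMod 𝒜} (R : GrProjRes M) (N : GrMod 𝒜) (i : ℕ) :
    AddSubgroup ((R.P i).carrier →ₗ[A] N.carrier) where
  carrier := {f | f ∈ grHom (R.P i) N ∧ f ∘ₗ R.d i = 0}
  zero_mem' := ⟨zero_mem _, LinearMap.zero_comp _⟩
  add_mem' := by
    rintro f g ⟨hf, hf'⟩ ⟨hg, hg'⟩
    exact ⟨add_mem hf hg, by rw [LinearMap.add_comp, hf', hg', add_zero]⟩
  neg_mem' := by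
    rintro f ⟨hf, hf'⟩
    exact ⟨neg_mem hf, by rw [LinearMap.neg_comp, hf', neg_zero]⟩

/-- The `i`-coboundaries of the complex `hom_A(P_•, N)`. -/
def GrProjRes.coboundaries {M : GrMod 𝒜} (R : GrProjRes M) (N : GrMod 𝒜) :
    (i : ℕ) → AddSubgroup ((R.P i).carrier →ₗ[A] N.carrier)
  | 0 => ⊥
  | i + 1 => (grHom (R.P i) N).map
      { toFun := fun g => g ∘ₗ R.d i
        map_zero' := LinearMap.zero_comp _
        map_add' := fun f g => LinearMap.add_comp (R.d i) g f }

/-- `ext^i_A(M, N) ≠ 0`, where `ext` is formed in the category of graded modules: for a graded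
projective resolution `P_•` of `M`, the `i`th cohomology of `hom_A(P_•, N)` is nonzero. -/
def GrExtNonzero (i : ℕ) (M N : GrMod 𝒜) : Prop :=
  ∃ R : GrProjRes M, ¬ R.cocycles N i ≤ R.coboundaries N i

variable {Λ : Type v} [PartialOrder Λ]

/-- The graded algebra `A` is `n`-Q-Koszul: `A_0` is quasi-hereditary with weight poset `Λ`, and
`ext^i_A(Δ⁰(l), ∇_0(m)⟨j⟩) ≠ 0` with `0 < i ≤ n` implies `i = j`. -/
structure IsQKoszul (𝒜 : ℕ → Submodule k A) [GradedAlgebra 𝒜] (e : Λ → GrZero 𝒜) (n : ℕ) :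
    Prop where
  quasiHereditary : IsQuasiHereditary k e
  ext_concentrated : ∀ (l m : Λ) (i : ℕ) (j : ℤ), 0 < i → i ≤ n →
    GrExtNonzero i (inflate 𝒜 (Std e l)) ((inflate 𝒜 (Costd k e m)).shift j) → (i : ℤ) = j

/-- The grade `s` part `(A e_l)_s = A e_l ∩ A_s` of `P(l) = A e_l`, an `A_0`-submodule. -/
def projCoverGrade (𝒜 : ℕ → Submodule k A) [GradedAlgebra 𝒜] (e : Λ → GrZero 𝒜) (l : Λ)
    (s : ℕ) : Submodule (GrZero 𝒜) (projCover (fun m => (e m : A)) l) where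
  carrier := {x | (x : A) ∈ 𝒜 s}
  zero_mem' := (𝒜 s).zero_mem
  add_mem' := fun {_ _} hx hy => (𝒜 s).add_mem hx hy
  smul_mem' := by
    intro a x hx
    have := SetLike.GradedMul.mul_mem (A := 𝒜) a.2 hx
    rwa [zero_add] at this

/-- The grade `s` part `Δ(l)_s` of the standard `A`-module `Δ(l)`, an `A_0`-module. The grading of
`Δ(l)` is the one for which the quotient map `A e_l → Δ(l)` is a map of graded modules. -/
def StdGrade (𝒜 : ℕ → Submodule k A) [GradedAlgebra 𝒜] (e : Λ → GrZero 𝒜) (l : Λ) (s : ℕ) :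
    Submodule (GrZero 𝒜) (Std (fun m => (e m : A)) l) :=
  (projCoverGrade 𝒜 e l s).map
    ((truncKer (fun m => (e m : A)) l (projCover (fun m => (e m : A)) l)).mkQ.restrictScalars
      (GrZero 𝒜))

end Graded

end QKoszul

/-! Fix `γ`, write `Δ` for `Δ(γ)`, and prove `Ext^s_{A_0}(Δ_s, ∇_0(ν)) = 0` by strong induction on
`s` (`IsQKoszul.extZero_stdGrade_self`). Unless `ν < γ`, this is a weight argument over `A_0`. If `ν
< γ`, quasi-heredity of `A` gives `Ext^s_A(Δ, ∇_0(ν)) = 0`, hence `ext^s_A(Δ, ∇_0(ν)⟨s⟩) = 0`. The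
grades `t < s` are then peeled off along `0 → Δ_{≥t+1} → Δ_{≥t} → Δ_t → 0`. The obstruction is
`ext^{s+1}_A(Δ_t, ∇_0(ν)⟨s⟩)`. By induction `Δ_t` has a resolution of length `max(t-1, 0)` by
`Δ⁰`-filtered modules, so the obstruction vanishes by Q-Koszulity in degrees up to `s+1 ≤ n+1`
(`IsQKoszul.grExtVanish_of_extZero`). What remains is `Δ_{≥s}`, whose lowest grade is `s`. Graded
maps from it to a module in grade `s` are `A_0`-maps from `Δ_s`, and `ext^s_A` becomes `Ext^s_{A_0}`
(`GrExtVanish.extZero_grade`).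

The other ingredient is the homological criterion for a quasi-hereditary algebra: a finite module
`V` with `Ext^1(V, ∇(m)) = 0` for all `m` has a `Δ`-filtration
(`IsQuasiHereditary.hasStdFiltration_of_extZero`). With dimension shifting it propagates the
vanishing from degree `s` to all `r ≥ s`, and it yields the filtrations of the syzygies.

Graded Ext is handled only through its vanishing, by recursion along projective presentations; the
index is shifted, so `GrExtVanish i` concerns `ext^{i+1}`. -/

set_option linter.unusedSectionVars false

namespace QKoszul

open CategoryTheory

/-! ### Vanishing of Ext groups of modules -/

section ExtVanishing

variable {R : Type u} [Ring R]

/-- `Ext^n_R(X, Y) = 0`. -/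
abbrev ExtZero (R : Type u) [Ring R] (X Y : Type u) [AddCommGroup X] [Module R X]
    [AddCommGroup Y] [Module R Y] (n : ℕ) : Prop :=
  Subsingleton (Abelian.Ext (ModuleCat.of R X) (ModuleCat.of R Y) n)

/-- A short exact sequence `0 → X → Y → Z → 0` of modules. -/
structure IsSES {X Y Z : Type*} [AddCommGroup X] [Module R X] [AddCommGroup Y] [Module R Y]
    [AddCommGroup Z] [Module R Z] (f : X →ₗ[R] Y) (g : Y →ₗ[R] Z) : Prop where
  inj : Function.Injective f
  surj : Function.Surjective g
  exact : Function.Exact f g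

theorem isSES_subtype_mkQ {M : Type*} [AddCommGroup M] [Module R M] (N : Submodule R M) :
    IsSES N.subtype N.mkQ :=
  ⟨N.injective_subtype, N.mkQ_surjective, LinearMap.exact_subtype_mkQ N⟩

theorem isSES_ker {M N : Type*} [AddCommGroup M] [Module R M] [AddCommGroup N] [Module R N]
    {g : M →ₗ[R] N} (hg : Function.Surjective g) : IsSES (LinearMap.ker g).subtype g :=
  ⟨Submodule.injective_subtype _, hg, LinearMap.exact_subtype_ker_map g⟩

variable {X Y Z W V : Type u} [AddCommGroup X] [Module R X] [AddCommGroup Y] [Module R Y]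
  [AddCommGroup Z] [Module R Z] [AddCommGroup W] [Module R W] [AddCommGroup V] [Module R V]
  {f : X →ₗ[R] Y} {g : Y →ₗ[R] Z}

/-- The short exact sequence as a short complex in the category of modules. -/
abbrev IsSES.shortComplex (h : IsSES f g) : ShortComplex (ModuleCat.{u} R) :=
  ShortComplex.mk (ModuleCat.ofHom f) (ModuleCat.ofHom g) (by
    rw [← ModuleCat.ofHom_comp, h.exact.linearMap_comp_eq_zero]; rfl)

theorem IsSES.shortExact (h : IsSES f g) : h.shortComplex.ShortExact :=
  ModuleCat.shortComplex_shortExact _ h.exact h.inj h.surj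

/-- The names `left`, `mid`, `right` say which term of the sequence has vanishing Ext; a prime marks
long exact sequences in the second variable. -/
theorem IsSES.extZero_mid (h : IsSES f g) {n : ℕ} (h₁ : ExtZero R X W n) (h₃ : ExtZero R Z W n) :
    ExtZero R Y W n := by
  refine subsingleton_of_forall_eq 0 fun x => ?_
  obtain ⟨y, rfl⟩ := Abelian.Ext.contravariant_sequence_exact₂ h.shortExact _ x
    (Subsingleton.elim (α := Abelian.Ext (ModuleCat.of R X) (ModuleCat.of R W) _) _ _)
  rw [Subsingleton.elim (α := Abelian.Ext (ModuleCat.of R Z) (ModuleCat.of R W) _) y 0,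
    Abelian.Ext.comp_zero]

theorem IsSES.extZero_left (h : IsSES f g) {n : ℕ} (h₂ : ExtZero R Y W n)
    (h₃ : ExtZero R Z W (n + 1)) : ExtZero R X W n := by
  refine subsingleton_of_forall_eq 0 fun x => ?_
  obtain ⟨y, rfl⟩ := Abelian.Ext.contravariant_sequence_exact₁ h.shortExact _ x (add_comm 1 n)
    (Subsingleton.elim (α := Abelian.Ext (ModuleCat.of R Z) (ModuleCat.of R W) _) _ _)
  rw [Subsingleton.elim (α := Abelian.Ext (ModuleCat.of R Y) (ModuleCat.of R W) _) y 0,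
    Abelian.Ext.comp_zero]

theorem IsSES.extZero_right (h : IsSES f g) {n : ℕ} (h₁ : ExtZero R X W n)
    (h₂ : ExtZero R Y W (n + 1)) : ExtZero R Z W (n + 1) := by
  refine subsingleton_of_forall_eq 0 fun x => ?_
  obtain ⟨y, rfl⟩ := Abelian.Ext.contravariant_sequence_exact₃ h.shortExact _ x
    (Subsingleton.elim (α := Abelian.Ext (ModuleCat.of R Y) (ModuleCat.of R W) _) _ _)
    (add_comm 1 n)
  rw [Subsingleton.elim (α := Abelian.Ext (ModuleCat.of R X) (ModuleCat.of R W) _) y 0,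
    Abelian.Ext.comp_zero]

theorem IsSES.extZero_mid' (h : IsSES f g) {n : ℕ} (h₁ : ExtZero R W X n) (h₃ : ExtZero R W Z n) :
    ExtZero R W Y n := by
  refine subsingleton_of_forall_eq 0 fun x => ?_
  obtain ⟨y, rfl⟩ := Abelian.Ext.covariant_sequence_exact₂ _ h.shortExact x
    (Subsingleton.elim (α := Abelian.Ext (ModuleCat.of R W) (ModuleCat.of R Z) _) _ _)
  rw [Subsingleton.elim (α := Abelian.Ext (ModuleCat.of R W) (ModuleCat.of R X) _) y 0,
    Abelian.Ext.zero_comp]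

theorem IsSES.extZero_left' (h : IsSES f g) {n : ℕ} (h₃ : ExtZero R W Z n)
    (h₂ : ExtZero R W Y (n + 1)) : ExtZero R W X (n + 1) := by
  refine subsingleton_of_forall_eq 0 fun x => ?_
  obtain ⟨y, rfl⟩ := Abelian.Ext.covariant_sequence_exact₁ _ h.shortExact x
    (Subsingleton.elim (α := Abelian.Ext (ModuleCat.of R W) (ModuleCat.of R Y) _) _ _) rfl
  rw [Subsingleton.elim (α := Abelian.Ext (ModuleCat.of R W) (ModuleCat.of R Z) _) y 0,
    Abelian.Ext.zero_comp]

theorem extZero_of_projective (P W : Type u) [AddCommGroup P] [Module R P] [AddCommGroup W]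
    [Module R W] [Module.Projective R P] (n : ℕ) : ExtZero R P W (n + 1) := by
  have := (IsProjective.iff_projective (R := R) (P := P)).1 inferInstance
  exact subsingleton_of_forall_eq 0 fun x => Abelian.Ext.eq_zero_of_projective x

theorem extZero_of_injective (W I : Type u) [AddCommGroup I] [Module R I] [AddCommGroup W]
    [Module R W] [Module.Injective R I] (n : ℕ) : ExtZero R W I (n + 1) := by
  have := (Module.injective_iff_injective_object R I).1 inferInstance
  exact subsingleton_of_forall_eq 0 fun x => Abelian.Ext.eq_zero_of_injective x

theorem extZero_zero_iff : ExtZero R X W 0 ↔ ∀ f : X →ₗ[R] W, f = 0 := by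
  constructor
  · intro h f
    have := (Abelian.Ext.homEquiv₀ (X := ModuleCat.of R X)
      (Y := ModuleCat.of R W)).symm.injective.subsingleton
    have := Subsingleton.elim (ModuleCat.ofHom f) (ModuleCat.ofHom 0)
    exact congrArg ModuleCat.Hom.hom this
  · intro h
    have : Subsingleton (ModuleCat.of R X ⟶ ModuleCat.of R W) :=
      ⟨fun a b => by
        apply ModuleCat.hom_ext
        rw [h a.hom, h b.hom]⟩
    exact (Abelian.Ext.homEquiv₀ (X := ModuleCat.of R X)
      (Y := ModuleCat.of R W)).injective.subsingleton

theorem extZero_of_subsingleton [Subsingleton X] (n : ℕ) : ExtZero R X W n := by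
  cases n with
  | zero => exact extZero_zero_iff.2 fun f => Subsingleton.elim _ _
  | succ n => exact extZero_of_projective X W n

/-- An isomorphism is a short exact sequence with third term zero. -/
theorem ExtZero.congr_left (e : X ≃ₗ[R] Y) {n : ℕ} (h : ExtZero R X W n) : ExtZero R Y W n :=
  IsSES.extZero_mid (f := e.toLinearMap) (g := (0 : Y →ₗ[R] PUnit.{u+1}))
    ⟨e.injective, fun _ => ⟨0, Subsingleton.elim _ _⟩,
      fun y => ⟨fun _ => e.surjective y, fun _ => Subsingleton.elim _ _⟩⟩
    h (extZero_of_subsingleton n)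

theorem ExtZero.of_subsingleton_right [Subsingleton Y] (n : ℕ) : ExtZero R X Y n := by
  have hz : Limits.IsZero (ModuleCat.of R Y) := ModuleCat.isZero_of_subsingleton _
  cases n with
  | zero => exact extZero_zero_iff.2 fun f => Subsingleton.elim _ _
  | succ n =>
    have := hz.injective
    exact subsingleton_of_forall_eq 0 fun x => Abelian.Ext.eq_zero_of_injective x

/-- If `Ext^1(Z, W) = 0` then every homomorphism from `X` to `W` extends to `Y`. -/
theorem IsSES.exists_extend (h : IsSES f g) (h₁ : ExtZero R Z W 1) (a : X →ₗ[R] W) :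
    ∃ b : Y →ₗ[R] W, b ∘ₗ f = a := by
  obtain ⟨y, hy⟩ := Abelian.Ext.contravariant_sequence_exact₁ h.shortExact (ModuleCat.of R W)
    (Abelian.Ext.mk₀ (ModuleCat.ofHom a)) (n₁ := 1) rfl
    (Subsingleton.elim (α := Abelian.Ext (ModuleCat.of R Z) (ModuleCat.of R W) _) _ _)
  obtain ⟨b, rfl⟩ := (Abelian.Ext.mk₀_bijective _ _).2 y
  rw [Abelian.Ext.mk₀_comp_mk₀] at hy
  have := (Abelian.Ext.mk₀_bijective _ _).1 hy
  exact ⟨b.hom, congrArg ModuleCat.Hom.hom this⟩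

/-- If `Ext^1(W, X) = 0` then every homomorphism from `W` to `Z` lifts to `Y`. -/
theorem IsSES.exists_lift (h : IsSES f g) (h₁ : ExtZero R W X 1) (a : W →ₗ[R] Z) :
    ∃ b : W →ₗ[R] Y, g ∘ₗ b = a := by
  obtain ⟨y, hy⟩ := Abelian.Ext.covariant_sequence_exact₃ (ModuleCat.of R W) h.shortExact
    (Abelian.Ext.mk₀ (ModuleCat.ofHom a)) (n₁ := 1) rfl
    (Subsingleton.elim (α := Abelian.Ext (ModuleCat.of R W) (ModuleCat.of R X) _) _ _)
  obtain ⟨b, rfl⟩ := (Abelian.Ext.mk₀_bijective _ _).2 y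
  rw [Abelian.Ext.mk₀_comp_mk₀] at hy
  have := (Abelian.Ext.mk₀_bijective _ _).1 hy
  exact ⟨b.hom, congrArg ModuleCat.Hom.hom this⟩

/-- If `Y` is projective and every homomorphism from `X` to `W` extends to `Y`, then
`Ext^1(Z, W) = 0`. -/
theorem IsSES.extZero_one_of_extend (h : IsSES f g) [Module.Projective R Y]
    (H : ∀ a : X →ₗ[R] W, ∃ b : Y →ₗ[R] W, b ∘ₗ f = a) : ExtZero R Z W 1 := by
  refine subsingleton_of_forall_eq 0 fun x => ?_
  obtain ⟨y, rfl⟩ := Abelian.Ext.contravariant_sequence_exact₃ h.shortExact _ x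
    ((extZero_of_projective (R := R) Y W 0).elim _ _) (n₀ := 0) rfl
  obtain ⟨a, rfl⟩ := (Abelian.Ext.mk₀_bijective _ _).2 y
  obtain ⟨b, hb⟩ := H a.hom
  -- Since `Y` is projective, every class is the pushout of the extension class along some `a : X →
  -- W`. If `a` factors through `f`, this pushout splits.
  have : a = ModuleCat.ofHom f ≫ ModuleCat.ofHom b := by
    apply ModuleCat.hom_ext; exact hb.symm
  rw [this, ← Abelian.Ext.mk₀_comp_mk₀, ← Abelian.Ext.comp_assoc _ _ _ (by rfl) (by rfl) (by rfl)]
  rw [h.shortExact.extClass_comp, Abelian.Ext.zero_comp]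

end ExtVanishing

/-! ### Quasi-hereditary algebras -/

section StdModules

variable {k B : Type u} [Field k] [Ring B] [Algebra k B] {Λ : Type v} [PartialOrder Λ] {e : Λ → B}

theorem IsWeightSystem.idem (h : IsWeightSystem e) (l : Λ) : e l * e l = e l := (h.primitive l).1

/-- The generator of the standard module `Δ(l)`, the class of `e l`. -/
def stdGen (e : Λ → B) (l : Λ) : Std e l :=
  (truncKer e l (projCover e l)).mkQ ⟨e l, Submodule.mem_span_singleton_self _⟩

theorem exists_smul_stdGen (l : Λ) (x : Std e l) : ∃ b : B, x = b • stdGen e l := by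
  obtain ⟨⟨y, hy⟩, rfl⟩ := Submodule.mkQ_surjective _ x
  obtain ⟨b, rfl⟩ := Submodule.mem_span_singleton.1 hy
  exact ⟨b, rfl⟩

theorem smul_stdGen {l : Λ} (hl : e l * e l = e l) : e l • stdGen e l = stdGen e l := by
  unfold stdGen
  rw [← map_smul]
  congr 1
  exact Subtype.ext hl

theorem smul_std_eq_zero {l m : Λ} (h : ¬ m ≤ l) (x : Std e l) : e m • x = 0 := by
  obtain ⟨y, rfl⟩ := Submodule.mkQ_surjective _ x
  rw [← map_smul, Submodule.mkQ_apply, Submodule.Quotient.mk_eq_zero]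
  exact Submodule.subset_span ⟨m, h, y, rfl⟩

theorem std_finite (l : Λ) : Module.Finite B (Std e l) :=
  Module.Finite.of_surjective (LinearMap.toSpanSingleton B (Std e l) (stdGen e l)) fun x =>
    (exists_smul_stdGen l x).imp fun _ h => h.symm

/-- `Δ(l)` is generated by a vector fixed by `e l`, and the image of that vector must vanish. -/
theorem hom_std_eq_zero {l : Λ} (hl : e l * e l = e l) {N : Type*} [AddCommGroup N] [Module B N]
    (hN : ∀ x : N, e l • x = 0) (f : Std e l →ₗ[B] N) : f = 0 := by
  ext x
  obtain ⟨b, hb⟩ := exists_smul_stdGen l ((truncKer e l (projCover e l)).mkQ x)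
  change f ((truncKer e l (projCover e l)).mkQ x) = 0
  rw [hb, ← smul_stdGen hl, map_smul, map_smul, hN, smul_zero]

/-- Right multiplication by the idempotent `e l` retracts `B` onto `B e_l`. -/
theorem projCover_projective {l : Λ} (hl : e l * e l = e l) :
    Module.Projective B (projCover e l) := by
  refine Module.Projective.of_split (projCover e l).subtype
    ((LinearMap.toSpanSingleton B B (e l)).codRestrict (projCover e l) fun b =>
      Submodule.mem_span_singleton.2 ⟨b, rfl⟩) ?_
  ext ⟨x, hx⟩
  obtain ⟨b, rfl⟩ := Submodule.mem_span_singleton.1 hx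
  simp [mul_assoc, hl]

theorem mem_map_iff_of_injective {M N : Type*} [AddCommGroup M] [Module B M] [AddCommGroup N]
    [Module B N] {f : M →ₗ[B] N} (hf : Function.Injective f) {F : Submodule B M} {x : M} :
    f x ∈ F.map f ↔ x ∈ F :=
  ⟨fun ⟨_, hy, h⟩ => hf h ▸ hy, Submodule.mem_map_of_mem⟩

/-- Replaces an isomorphism with a subquotient by a surjection with prescribed kernel, which is
easier to transport. -/
theorem nonempty_section_equiv_iff {M N : Type*} [AddCommGroup M] [Module B M] [AddCommGroup N]
    [Module B N] (F G : Submodule B M) :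
    Nonempty ((G ⧸ F.submoduleOf G) ≃ₗ[B] N) ↔
      ∃ g : G →ₗ[B] N, Function.Surjective g ∧ ∀ x, g x = 0 ↔ (x : M) ∈ F := by
  constructor
  · rintro ⟨φ⟩
    refine ⟨φ.toLinearMap ∘ₗ (F.submoduleOf G).mkQ,
      φ.surjective.comp (Submodule.mkQ_surjective _), fun x => ?_⟩
    rw [LinearMap.comp_apply, LinearEquiv.coe_coe, LinearEquiv.map_eq_zero_iff,
      Submodule.mkQ_apply, Submodule.Quotient.mk_eq_zero]
    exact Iff.rfl
  · rintro ⟨g, hg, hk⟩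
    have : F.submoduleOf G = LinearMap.ker g := by
      ext x
      rw [LinearMap.mem_ker, hk]
      exact Iff.rfl
    rw [this]
    exact ⟨g.quotKerEquivOfSurjective hg⟩

/-- Induction along a filtration with standard sections. -/
theorem HasStdFiltrationOn.induction {Γ : Set Λ}
    {p : ∀ (M : Type u) [AddCommGroup M] [Module B M], Prop}
    (zero : ∀ (M : Type u) [AddCommGroup M] [Module B M], Subsingleton M → p M)
    (std : ∀ m ∈ Γ, p (Std e m))
    (ses : ∀ (X Y Z : Type u) [AddCommGroup X] [Module B X] [AddCommGroup Y] [Module B Y]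
      [AddCommGroup Z] [Module B Z] (f : X →ₗ[B] Y) (g : Y →ₗ[B] Z), IsSES f g → p X → p Z → p Y)
    {M : Type u} [AddCommGroup M] [Module B M] (h : HasStdFiltrationOn e Γ M) : p M := by
  obtain ⟨t, F, hF, h0, ht, hs⟩ := h
  have key : ∀ i ≤ t, p (F i) := by
    intro i
    induction i with
    | zero => intro _; apply zero; rw [h0]; infer_instance
    | succ i ih =>
      intro hi
      obtain ⟨m, hm, hφ⟩ := hs i hi
      obtain ⟨g, hg, hk⟩ := (nonempty_section_equiv_iff _ _).1 hφ
      refine ses _ _ _ (Submodule.inclusion (hF i.le_succ)) g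
        ⟨Submodule.inclusion_injective _, hg, fun x => ?_⟩ (ih (Nat.le_of_succ_le hi)) (std m hm)
      rw [hk]
      exact ⟨fun hx => ⟨⟨x, hx⟩, rfl⟩, by rintro ⟨y, rfl⟩; exact y.2⟩
  have := key t le_rfl
  rw [ht] at this
  -- Invariance of `p` under isomorphism is not assumed; a sequence with zero left term carries `p`
  -- from the submodule `⊤` to `M`.
  have hz : p PUnit.{u+1} := zero _ inferInstance
  exact ses _ _ _ (0 : PUnit.{u+1} →ₗ[B] M) Submodule.topEquiv.symm.toLinearMap
    ⟨fun _ _ _ => Subsingleton.elim _ _, Submodule.topEquiv.symm.surjective, fun x => by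
      simp [eq_comm (a := (0 : M))]⟩
    hz this

theorem HasStdFiltrationOn.extZero {Γ : Set Λ} {M W : Type u} [AddCommGroup M] [Module B M]
    [AddCommGroup W] [Module B W] (h : HasStdFiltrationOn e Γ M) {n : ℕ}
    (H : ∀ m ∈ Γ, ExtZero B (Std e m) W n) : ExtZero B M W n :=
  h.induction (p := fun M _ _ => ExtZero B M W n) (fun _ _ _ _ => extZero_of_subsingleton n) H
    (fun _ _ _ _ _ _ _ _ _ _ _ hs hX hZ => hs.extZero_mid hX hZ)

theorem HasStdFiltration.of_subsingleton {M : Type u} [AddCommGroup M] [Module B M]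
    [Subsingleton M] : HasStdFiltration e M :=
  ⟨0, fun _ => ⊥, monotone_const, rfl, Subsingleton.elim _ _, fun _ h => absurd h (by simp)⟩

/-- A module `Y` with a `Δ`-filtered submodule `X` such that `Y / X` is standard has a
`Δ`-filtration. -/
theorem HasStdFiltration.of_ses {X Y : Type u} [AddCommGroup X] [Module B X] [AddCommGroup Y]
    [Module B Y] {l : Λ} {f : X →ₗ[B] Y} {g : Y →ₗ[B] Std e l} (h : IsSES f g)
    (hX : HasStdFiltration e X) : HasStdFiltration e Y := by
  obtain ⟨t, F, hF, h0, ht, hs⟩ := hX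
  obtain ⟨F', h₁, h₂⟩ : ∃ F' : ℕ → Submodule B Y, (∀ i ≤ t, F' i = (F i).map f) ∧
      ∀ i, ¬ i ≤ t → F' i = ⊤ :=
    ⟨fun i => if i ≤ t then (F i).map f else ⊤, fun i hi => if_pos hi, fun i hi => if_neg hi⟩
  refine ⟨t + 1, F', ?_, ?_, h₂ _ (by simp), ?_⟩
  · intro i j hij
    by_cases hj : j ≤ t
    · rw [h₁ j hj, h₁ i (hij.trans hj)]
      exact Submodule.map_mono (hF hij)
    · rw [h₂ j hj]
      exact le_top
  · rw [h₁ 0 (Nat.zero_le t), h0, Submodule.map_bot]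
  · intro i hi
    simp only [nonempty_section_equiv_iff] at hs ⊢
    rcases Nat.lt_succ_iff_lt_or_eq.1 hi with hi' | rfl
    · obtain ⟨m, hm, a, ha, hk⟩ := hs i hi'
      refine ⟨m, hm, ?_⟩
      rw [h₁ i hi'.le, h₁ (i + 1) hi']
      let E := Submodule.equivMapOfInjective f h.inj (F (i + 1))
      refine ⟨a ∘ₗ E.symm.toLinearMap, ha.comp E.symm.surjective, fun x => ?_⟩
      obtain ⟨y, rfl⟩ := E.surjective x
      rw [LinearMap.comp_apply, LinearEquiv.coe_coe, E.symm_apply_apply, hk,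
        Submodule.coe_equivMapOfInjective_apply]
      exact (mem_map_iff_of_injective h.inj).symm
    · refine ⟨l, trivial, ?_⟩
      rw [h₁ i le_rfl, h₂ (i + 1) (by simp), ht, Submodule.map_top]
      refine ⟨g ∘ₗ (⊤ : Submodule B Y).subtype, fun z => ?_, fun x => h.exact x.1⟩
      obtain ⟨y, rfl⟩ := h.surj z
      exact ⟨⟨y, trivial⟩, rfl⟩

theorem HasStdFiltration.congr {X Y : Type u} [AddCommGroup X] [Module B X] [AddCommGroup Y]
    [Module B Y] (E : X ≃ₗ[B] Y) (hX : HasStdFiltration e X) : HasStdFiltration e Y := by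
  obtain ⟨t, F, hF, h0, ht, hs⟩ := hX
  refine ⟨t, fun i => (F i).map E.toLinearMap, fun i j hij => Submodule.map_mono (hF hij),
    by simp [h0], by simp [ht], fun i hi => ?_⟩
  obtain ⟨m, hm, hφ⟩ := hs i hi
  refine ⟨m, hm, ?_⟩
  obtain ⟨a, ha, hk⟩ := (nonempty_section_equiv_iff _ _).1 hφ
  rw [nonempty_section_equiv_iff]
  have hE : Function.Injective E.toLinearMap := E.injective
  let E' := Submodule.equivMapOfInjective E.toLinearMap hE (F (i + 1))
  refine ⟨a ∘ₗ E'.symm.toLinearMap, ha.comp E'.symm.surjective, fun x => ?_⟩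
  obtain ⟨y, rfl⟩ := E'.surjective x
  rw [LinearMap.comp_apply, LinearEquiv.coe_coe, E'.symm_apply_apply, hk,
    Submodule.coe_equivMapOfInjective_apply]
  exact (mem_map_iff_of_injective hE).symm

end StdModules

/-! ### Injective hulls and costandard modules -/

section Costandard

variable {k B : Type u} [Field k] [Ring B] [Algebra k B] {Λ : Type v} [PartialOrder Λ] {e : Λ → B}

theorem coreg_ext {f g : Coreg k B} (h : ∀ x, f x = g x) : f = g :=
  DFunLike.ext (F := Module.Dual k B) f g h

/-- The homomorphism `X → I(l)` defined by a linear form on `X`. -/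
def toInjHull {l : Λ} (hl : e l * e l = e l) {X : Type*} [AddCommGroup X] [Module B X] [Module k X]
    [IsScalarTower k B X] (φ : X →ₗ[k] k) : X →ₗ[B] injHull k e l where
  toFun y := ⟨show Module.Dual k B from
    { toFun := fun b => φ (e l • b • y)
      map_add' := fun b c => by rw [add_smul, smul_add, map_add]
      map_smul' := fun c b => by
        rw [smul_assoc, ← algebraMap_smul B c (b • y), ← mul_smul, ← Algebra.commutes, mul_smul,
          algebraMap_smul, map_smul]
        rfl }, fun x => by
    change φ (e l • x • y) = φ (e l • (e l * x) • y)
    rw [← mul_smul, ← mul_smul, ← mul_assoc, hl]⟩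
  map_add' y z := Subtype.ext (coreg_ext fun b => by
    change φ (e l • b • (y + z)) = φ (e l • b • y) + φ (e l • b • z)
    rw [smul_add, smul_add, map_add])
  map_smul' b y := Subtype.ext (coreg_ext fun c => by
    change φ (e l • c • (b • y)) = φ (e l • (c * b) • y)
    rw [← mul_smul c b])

theorem injHull_injective {l : Λ} (hl : e l * e l = e l) :
    Module.Injective B (injHull k e l) := by
  refine ⟨fun X Y _ _ _ _ f hf g => ?_⟩
  let _ : Module k X := Module.compHom X (algebraMap k B)
  let _ : Module k Y := Module.compHom Y (algebraMap k B)
  have hX : ∀ (c : k) (x : X), c • x = algebraMap k B c • x := fun _ _ => rfl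
  have hY : ∀ (c : k) (x : Y), c • x = algebraMap k B c • x := fun _ _ => rfl
  have : IsScalarTower k B Y := ⟨fun c b y => by rw [hY, ← mul_smul, Algebra.smul_def]⟩
  let f' : X →ₗ[k] Y :=
    { toFun := f, map_add' := map_add f, map_smul' := fun c x => f.map_smul (algebraMap k B c) x }
  -- A `k`-linear retraction suffices, because maps into `I(l)` correspond to linear forms: `g` is
  -- recovered from `x ↦ g(x)(1)`.
  obtain ⟨r, hr⟩ := LinearMap.exists_leftInverse_of_injective f' (LinearMap.ker_eq_bot.2 hf)
  have hr' : ∀ x, r (f x) = x := fun x => LinearMap.congr_fun hr x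
  let φ : X →ₗ[k] k :=
    { toFun := fun x => (g x).1 1
      map_add' := fun x y => by rw [map_add]; rfl
      map_smul' := fun c x => by
        rw [hX, map_smul, Submodule.coe_smul, Coreg.smul_apply, one_mul,
          Algebra.algebraMap_eq_smul_one]
        exact LinearMap.map_smul (show Module.Dual k B from (g x).1) c 1 }
  refine ⟨toInjHull hl (φ ∘ₗ r), fun x => Subtype.ext (coreg_ext fun b => ?_)⟩
  change φ (r (e l • b • f x)) = _
  rw [← map_smul, ← map_smul, hr']
  change (g (e l • b • x)).1 1 = _
  rw [map_smul, map_smul, (g x).2 b]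
  change (g x).1 (1 * e l * b) = _
  rw [one_mul]

theorem smul_costd_eq_zero {l m : Λ} (h : ¬ m ≤ l) (x : Costd k e l) : e m • x = 0 := by
  have := x.2 m h 1
  rw [one_smul] at this
  exact Subtype.ext this

/-- Every value of `f x` is seen in weight `l`: `f(x)(b) = f(x)(e_l b) = f(e_l b x)(1)`. -/
theorem hom_costd_eq_zero {l : Λ} {N : Type*} [AddCommGroup N] [Module B N]
    (hN : ∀ x : N, e l • x = 0) (f : N →ₗ[B] Costd k e l) : f = 0 := by
  refine LinearMap.ext fun x => Subtype.ext (Subtype.ext (coreg_ext fun b => ?_))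
  have h1 : (f x).1.1 b = (f (e l • b • x)).1.1 1 := by
    rw [(f x).1.2 b, map_smul, map_smul]
    change _ = (f x).1.1 (1 * e l * b)
    rw [one_mul]
  rw [h1, hN, map_zero]
  rfl

/-- `Ext^1(N, ∇(l)) = 0` when all the weights of `N` are `≤ l`. -/
theorem extZero_costd_one_of_le {l : Λ} (he : ∀ m, e m * e m = e m) {N : Type u} [AddCommGroup N]
    [Module B N] (hN : ∀ m, ¬ m ≤ l → ∀ x : N, e m • x = 0) : ExtZero B N (Costd k e l) 1 := by
  have := injHull_injective (k := k) (he l)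
  refine (isSES_subtype_mkQ (truncSub e l (injHull k e l))).extZero_left'
    (extZero_zero_iff.2 fun f => ?_) (extZero_of_injective _ _ 0)
  ext n
  obtain ⟨x, hx⟩ := Submodule.mkQ_surjective _ (f n)
  rw [← hx, LinearMap.zero_apply, Submodule.mkQ_apply, Submodule.Quotient.mk_eq_zero]
  -- Maximality of `∇(l)` in `I(l)`: `e_m b x` maps to zero in the quotient because `N` has no
  -- weight `m`, so it lies in `∇(l)`, which is killed by `e_m`. Idempotency gives `e_m b x = 0`,
  -- hence `x ∈ ∇(l)`.
  intro m hm b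
  have h0 : (truncSub e l (injHull k e l)).mkQ (e m • b • x) = 0 := by
    rw [map_smul, map_smul, hx, ← map_smul, ← map_smul, hN m hm, map_zero]
  rw [Submodule.mkQ_apply, Submodule.Quotient.mk_eq_zero] at h0
  have := h0 m hm 1
  rwa [one_smul, ← mul_smul, he] at this

end Costandard

/-! ### Homological theory of quasi-hereditary algebras -/

section Homological

variable {k B : Type u} [Field k] [Ring B] [Algebra k B] {Λ : Type v} [PartialOrder Λ] {e : Λ → B}

theorem IsQuasiHereditary.idem (h : IsQuasiHereditary k e) (l : Λ) : e l * e l = e l :=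
  h.weights.idem l

/-- `Ext^{n+1}(Δ(l), N) = 0` when `N` has no weight `> l`. -/
theorem IsQuasiHereditary.extZero_std (h : IsQuasiHereditary k e) (n : ℕ) (l : Λ) {N : Type u}
    [AddCommGroup N] [Module B N] (hN : ∀ m, l < m → ∀ x : N, e m • x = 0) :
    ExtZero B (Std e l) N (n + 1) := by
  induction n generalizing l with
  | zero =>
    have := projCover_projective (h.idem l)
    -- The kernel of `P(l) → Δ(l)` is filtered by `Δ(m)` with `m > l`, and these have no nonzero
    -- maps to `N`.
    refine (isSES_subtype_mkQ (truncKer e l (projCover e l))).extZero_right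
      ((h.filtration l).extZero fun m hm => ?_) (extZero_of_projective _ _ _)
    exact extZero_zero_iff.2 fun f => hom_std_eq_zero (h.idem m) (hN m hm) f
  | succ n ih =>
    have := projCover_projective (h.idem l)
    exact (isSES_subtype_mkQ (truncKer e l (projCover e l))).extZero_right
      ((h.filtration l).extZero fun m hm => ih m fun m' hm' => hN m' (lt_trans hm hm'))
      (extZero_of_projective _ _ _)

/-- For `Ext^1`, if `l ≤ m` all weights of `Δ(l)` are `≤ m`; otherwise `∇(m)` has no weight `> l`.
Higher degrees follow by shifting along `P(l) → Δ(l)`. -/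
theorem IsQuasiHereditary.extZero_std_costd (h : IsQuasiHereditary k e) (n : ℕ) (l m : Λ) :
    ExtZero B (Std e l) (Costd k e m) (n + 1) := by
  induction n generalizing l with
  | zero =>
    by_cases hlm : l ≤ m
    · exact extZero_costd_one_of_le h.idem fun m' hm' x =>
        smul_std_eq_zero (fun hc => hm' (hc.trans hlm)) x
    · exact h.extZero_std 0 l fun m' hm' x =>
        smul_costd_eq_zero (fun hc => hlm (hm'.le.trans hc)) x
  | succ n ih =>
    have := projCover_projective (h.idem l)
    exact (isSES_subtype_mkQ (truncKer e l (projCover e l))).extZero_right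
      ((h.filtration l).extZero fun m hm => ih m)
      (extZero_of_projective _ _ _)

theorem IsQuasiHereditary.extZero_of_hasStdFiltration (h : IsQuasiHereditary k e) (n : ℕ) (m : Λ)
    {M : Type u} [AddCommGroup M] [Module B M] (hM : HasStdFiltration e M) :
    ExtZero B M (Costd k e m) (n + 1) :=
  HasStdFiltrationOn.extZero hM fun l _ => h.extZero_std_costd n l m

/-- Multiplicity one in usable form: `e_l Δ(l)` is the line spanned by the generator. -/
theorem IsQuasiHereditary.exists_smul_eq (h : IsQuasiHereditary k e) (l : Λ) :
    stdGen e l ≠ 0 ∧ ∀ x : Std e l, ∃ c : k, e l • x = algebraMap k B c • stdGen e l := by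
  obtain ⟨⟨w, hw⟩, hw0, hspan⟩ := finrank_eq_one_iff'.1 (h.mult_one l)
  have hgen : stdGen e l ∈ LinearMap.range (Algebra.lsmul k k (Std e l) (e l)) :=
    ⟨stdGen e l, smul_stdGen (h.idem l)⟩
  have h0 : stdGen e l ≠ 0 := by
    intro h0
    obtain ⟨y, hy⟩ := hw
    apply hw0
    obtain ⟨b, rfl⟩ := exists_smul_stdGen l y
    rw [h0, smul_zero, map_zero] at hy
    exact Subtype.ext hy.symm
  refine ⟨h0, fun x => ?_⟩
  obtain ⟨c, hc⟩ := hspan ⟨stdGen e l, hgen⟩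
  obtain ⟨d, hd⟩ := hspan ⟨e l • x, x, rfl⟩
  have hc' : c • w = stdGen e l := congrArg Subtype.val hc
  have hd' : d • w = e l • x := congrArg Subtype.val hd
  have hc0 : c ≠ 0 := by
    rintro rfl
    rw [zero_smul] at hc'
    exact h0 hc'.symm
  refine ⟨d * c⁻¹, ?_⟩
  rw [algebraMap_smul, ← hd', ← hc', smul_smul, mul_assoc, inv_mul_cancel₀ hc0, mul_one]

/-- A simple module of weight `l` is a quotient of `Δ(l)`, and the weights of the kernel
are `< l`. -/
theorem IsQuasiHereditary.exists_std_surjective (h : IsQuasiHereditary k e) {l : Λ} {S : Type u}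
    [AddCommGroup S] [Module B S] [IsSimpleModule B S] {x : S} (hx : e l • x ≠ 0) :
    ∃ q : Std e l →ₗ[B] S, Function.Surjective q ∧ q (stdGen e l) ≠ 0 ∧
      ∀ m, ¬ m < l → ∀ y ∈ LinearMap.ker q, e m • y = 0 := by
  have huniq : ∀ m, m ≠ l → ∀ y : S, e m • y = 0 := by
    intro m hm y
    by_contra hy
    exact hm ((h.weights.complete (ModuleCat.of B S) inferInstance).unique ⟨y, hy⟩ ⟨x, hx⟩)
  let p : projCover e l →ₗ[B] S :=
    (LinearMap.toSpanSingleton B S x).comp (projCover e l).subtype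
  have hp : truncKer e l (projCover e l) ≤ LinearMap.ker p := by
    refine Submodule.span_le.2 ?_
    rintro _ ⟨m, hm, y, rfl⟩
    rw [SetLike.mem_coe, LinearMap.mem_ker, map_smul]
    exact huniq m (fun hc => hm hc.le) _
  let q := (truncKer e l (projCover e l)).liftQ p hp
  have hq : q (stdGen e l) = e l • x := rfl
  have hq0 : q (stdGen e l) ≠ 0 := by rwa [hq]
  refine ⟨q, LinearMap.surjective_of_ne_zero ?_, hq0, ?_⟩
  · intro hc
    rw [hc] at hq0
    exact hq0 rfl
  · intro m hm y hy
    by_cases hml : m = l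
    · subst hml
      -- By multiplicity one `e_m y` is a multiple of the generator, which `q` does not kill, so the
      -- multiple is zero.
      obtain ⟨c, hc⟩ := (h.exists_smul_eq m).2 y
      have h0 : q (e m • y) = 0 := by rw [map_smul, LinearMap.mem_ker.1 hy, smul_zero]
      by_cases hc0 : c = 0
      · rw [hc, hc0, map_zero, zero_smul]
      · exfalso
        apply hq0
        rw [hc, map_smul] at h0
        have := congrArg (algebraMap k B c⁻¹ • ·) h0
        simpa [← mul_smul, ← map_mul, inv_mul_cancel₀ hc0] using this
    · exact smul_std_eq_zero (fun hc => hm (lt_of_le_of_ne hc hml)) y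

theorem isFiniteLength_of_finite [IsArtinianRing B] (N : Type u) [AddCommGroup N] [Module B N]
    [Module.Finite B N] : IsFiniteLength B N :=
  isFiniteLength_iff_isNoetherian_isArtinian.2 ⟨inferInstance, inferInstance⟩

/-- `Ext^{n+1}(N, ∇(m)) = 0` when `N` has no weight `> m`. -/
theorem IsQuasiHereditary.extZero_costd [IsArtinianRing B] (h : IsQuasiHereditary k e) (n : ℕ)
    (m : Λ) {N : Type u} [AddCommGroup N] [Module B N] [Module.Finite B N]
    (hN : ∀ l, m < l → ∀ x : N, e l • x = 0) : ExtZero B N (Costd k e m) (n + 1) := by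
  induction n generalizing N with
  | zero =>
    -- Dévissage to a simple `L(l)` with `l` not `> m`, covered by `Δ(l)`. This way no filtration of
    -- the injective hulls by costandard modules is needed.
    have hfl := isFiniteLength_of_finite (B := B) N
    induction hfl with
    | of_subsingleton => exact extZero_of_subsingleton _
    | @of_simple_quotient M _ _ N' _ _ ih =>
      refine (isSES_subtype_mkQ N').extZero_mid (ih fun l hl x => Subtype.ext (hN l hl x)) ?_
      obtain ⟨l, x, hx⟩ :=
        (h.weights.complete (ModuleCat.of B (M ⧸ N')) inferInstance).exists
      obtain ⟨q, hq, -, hw⟩ := h.exists_std_surjective (S := M ⧸ N') hx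
      have hml : ¬ m < l := by
        intro hc
        obtain ⟨y, rfl⟩ := Submodule.mkQ_surjective _ x
        apply hx
        rw [← map_smul, hN l hc, map_zero]
      -- The kernel of `Δ(l) → L(l)` has weights `< l`, hence not the weight `m`, so it has no
      -- nonzero maps to `∇(m)`.
      refine (isSES_ker hq).extZero_right (extZero_zero_iff.2 fun f => ?_)
        (h.extZero_std_costd _ _ _)
      exact hom_costd_eq_zero (fun y => Subtype.ext (hw m hml y.1 y.2)) f
  | succ n IH =>
    have hfl := isFiniteLength_of_finite (B := B) N
    induction hfl with
    | of_subsingleton => exact extZero_of_subsingleton _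
    | @of_simple_quotient M _ _ N' _ _ ih =>
      refine (isSES_subtype_mkQ N').extZero_mid (ih fun l hl x => Subtype.ext (hN l hl x)) ?_
      obtain ⟨l, x, hx⟩ :=
        (h.weights.complete (ModuleCat.of B (M ⧸ N')) inferInstance).exists
      obtain ⟨q, hq, -, hw⟩ := h.exists_std_surjective (S := M ⧸ N') hx
      have hml : ¬ m < l := by
        intro hc
        obtain ⟨y, rfl⟩ := Submodule.mkQ_surjective _ x
        apply hx
        rw [← map_smul, hN l hc, map_zero]
      have := std_finite (e := e) l
      -- A weight `l' > m` of the kernel would satisfy `m < l' < l`, so the induction on the degree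
      -- applies to the kernel.
      refine (isSES_ker hq).extZero_right (IH fun l' hl' y => ?_) (h.extZero_std_costd _ _ _)
      exact Subtype.ext (hw l' (fun hc => hml (hl'.trans hc)) y.1 y.2)

/-- Provides minimal weights of a head without any finiteness assumption on `Λ`. -/
theorem finite_weights (he : ∀ l, e l * e l = e l) (h : IsWeightSystem e) {N : Type u}
    [AddCommGroup N] [Module B N] (hfl : IsFiniteLength B N) :
    {l | ∃ x : N, e l • x ≠ 0}.Finite := by
  induction hfl with
  | of_subsingleton => 
    refine Set.finite_empty.subset ?_
    rintro l ⟨x, hx⟩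
    exact hx (Subsingleton.elim _ _)
  | @of_simple_quotient M _ _ N' _ _ ih =>
    obtain ⟨l₀, -, hl₀⟩ := h.complete (ModuleCat.of B (M ⧸ N')) inferInstance
    refine (ih.union (Set.finite_singleton l₀)).subset ?_
    rintro l ⟨x, hx⟩
    by_cases hl : e l • N'.mkQ x = 0
    · left
      rw [← map_smul, Submodule.mkQ_apply, Submodule.Quotient.mk_eq_zero] at hl
      refine ⟨⟨e l • x, hl⟩, fun hc => hx ?_⟩
      have := congrArg Subtype.val hc
      change e l • e l • x = 0 at this
      rwa [← mul_smul, he] at this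
    · right
      exact hl₀ l ⟨N'.mkQ x, hl⟩

/-- The two truncations are orthogonal under evaluation, since `(e_m y g)(b) = g(b e_m y)`. -/
theorem coreg_apply_eq_zero_of_mem_truncKer {l : Λ} {g : Coreg k B}
    (hg : ∀ m, ¬ m ≤ l → ∀ b : B, e m • b • g = 0) {z : projCover e l}
    (hz : z ∈ truncKer e l (projCover e l)) (b : B) : g (b * z) = 0 := by
  induction hz using Submodule.span_induction generalizing b with
  | mem x hx =>
    obtain ⟨m, hm, y, rfl⟩ := hx
    have := DFunLike.congr_fun (F := Module.Dual k B) (hg m hm y) b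
    change g (b * e m * y) = 0 at this
    rwa [mul_assoc] at this
  | zero => 
    change g (b * 0) = 0
    rw [mul_zero]
    exact LinearMap.map_zero (show Module.Dual k B from g)
  | add x y _ _ hx hy =>
    change g (b * (x + y)) = 0
    rw [mul_add]
    refine (LinearMap.map_add (show Module.Dual k B from g) _ _).trans ?_
    exact (congrArg₂ (· + ·) (hx b) (hy b)).trans (add_zero 0)
  | smul a x _ hx =>
    change g (b * (a * x)) = 0
    rw [← mul_assoc]
    exact hx _

/-- An element of `e_l ∇(l)` is determined by its value at `e_l`. -/
theorem IsQuasiHereditary.costd_apply (h : IsQuasiHereditary k e) (l : Λ) (x : B) :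
    ∃ c : k, ∀ g : Costd k e l, e l • g = g → g.1.1 x = c * g.1.1 (e l) := by
  obtain ⟨c, hc⟩ := (h.exists_smul_eq l).2 (x • stdGen e l)
  refine ⟨c, fun g hg => ?_⟩
  let z : projCover e l := ⟨e l, Submodule.mem_span_singleton_self _⟩
  -- On the generator of `Δ(l)` the element `e_l x e_l` acts as the scalar `c`; the difference lies
  -- in the truncation kernel, on which `g` vanishes.
  have hz : e l • x • z - algebraMap k B c • z ∈ truncKer e l (projCover e l) := by
    rw [← Submodule.Quotient.mk_eq_zero, ← Submodule.mkQ_apply, map_sub, map_smul, map_smul,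
      map_smul, sub_eq_zero]
    exact hc
  have h0 := coreg_apply_eq_zero_of_mem_truncKer (g := g.1.1)
    (fun m hm b => congrArg Subtype.val (g.2 m hm b)) hz 1
  have h1 : g.1.1 x = g.1.1 (e l * (x * e l)) := by
    conv_lhs => rw [← hg]
    change g.1.1 (x * e l) = _
    rw [← g.1.2 (x * e l)]
  have h2 : (1 : B) * ((e l • x • z - algebraMap k B c • z : projCover e l) : B) =
      e l * (x * e l) - c • e l := by
    rw [one_mul, Algebra.smul_def]
    rfl
  rw [h2] at h0
  have h3 : g.1.1 (e l * (x * e l) - c • e l) = g.1.1 (e l * (x * e l)) - c * g.1.1 (e l) := by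
    refine (LinearMap.map_sub (show Module.Dual k B from g.1.1) _ _).trans ?_
    exact congrArg _ (LinearMap.map_smul (show Module.Dual k B from g.1.1) c (e l))
  rw [h1]
  exact sub_eq_zero.1 (h3.symm.trans h0)

/-- A simple module of weight `l` embeds into `∇(l)`, and the weights of the cokernel
are `< l`. -/
theorem IsQuasiHereditary.exists_costd_injective (h : IsQuasiHereditary k e) {l : Λ} {S : Type u}
    [AddCommGroup S] [Module B S] [IsSimpleModule B S] {x : S} (hx : e l • x ≠ 0) :
    ∃ j : S →ₗ[B] Costd k e l, Function.Injective j ∧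
      ∀ m, ¬ m < l → ∀ y : Costd k e l, e m • y ∈ LinearMap.range j := by
  have huniq : ∀ m, m ≠ l → ∀ y : S, e m • y = 0 := by
    intro m hm y
    by_contra hy
    exact hm ((h.weights.complete (ModuleCat.of B S) inferInstance).unique ⟨y, hy⟩ ⟨x, hx⟩)
  let _ : Module k S := Module.compHom S (algebraMap k B)
  have hS : ∀ (c : k) (x : S), c • x = algebraMap k B c • x := fun _ _ => rfl
  have : IsScalarTower k B S := ⟨fun c b y => by rw [hS, ← mul_smul, Algebra.smul_def]⟩
  obtain ⟨φ, hφ⟩ := Module.Projective.exists_dual_ne_zero k hx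
  let j : S →ₗ[B] Costd k e l := (toInjHull (h.idem l) φ).codRestrict _ fun y m hm b => by
    rw [← map_smul, ← map_smul, huniq m (fun hc => hm hc.le), map_zero]
  have hj : j (e l • x) ≠ 0 := by
    intro h0
    have h1 : (j (e l • x)).1.1 1 = 0 := by rw [h0]; rfl
    change φ (e l • (1 : B) • e l • x) = 0 at h1
    rw [one_smul, ← mul_smul, h.idem] at h1
    exact hφ h1
  have hfix : e l • j (e l • x) = j (e l • x) := by
    rw [← map_smul, ← mul_smul, h.idem]
  refine ⟨j, ?_, ?_⟩
  · refine (LinearMap.injective_or_eq_zero j).resolve_right fun h0 => hj ?_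
    rw [h0, LinearMap.zero_apply]
  · intro m hm y
    by_cases hml : m = l
    · subst hml
      have hne : (j (e m • x)).1.1 (e m) ≠ 0 := by
        intro h0
        apply hj
        refine Subtype.ext (Subtype.ext (coreg_ext fun b => ?_))
        obtain ⟨c, hc⟩ := h.costd_apply m b
        rw [hc _ hfix, h0, mul_zero]
        rfl
      -- By `IsQuasiHereditary.costd_apply`, evaluation at `e_m` is a coordinate on `e_m ∇(m)`, so
      -- the ratio of coordinates writes `e_m y` as a multiple of `j (e_m x)`.
      refine ⟨algebraMap k B ((e m • y).1.1 (e m) / (j (e m • x)).1.1 (e m)) • e m • x, ?_⟩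
      rw [map_smul]
      refine Subtype.ext (Subtype.ext (coreg_ext fun b => ?_))
      obtain ⟨c, hc⟩ := h.costd_apply m b
      rw [hc (e m • y) (by rw [← mul_smul, h.idem])]
      change (j (e m • x)).1.1 (b * algebraMap k B _) = _
      rw [← Algebra.commutes, ← Algebra.smul_def]
      refine (LinearMap.map_smul (show Module.Dual k B from (j (e m • x)).1.1) _ b).trans ?_
      change _ * (j (e m • x)).1.1 b = _
      rw [hc _ hfix]
      field_simp
    · rw [smul_costd_eq_zero (fun hc => hm (lt_of_le_of_ne hc hml)) y]
      exact zero_mem _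

/-- If `V` has no simple quotient of weight `< l` and `Ext^1(V, ∇(m)) = 0` for all `m`, then
`Ext^1(V, N) = 0` for all `N` with weights `< l`. -/
theorem IsQuasiHereditary.extZero_one_of_head [IsArtinianRing B] (h : IsQuasiHereditary k e)
    {l : Λ} {V N : Type u} [AddCommGroup V] [Module B V] [Module.Finite B V] [AddCommGroup N]
    [Module B N] [Module.Finite B N] (hV : ∀ m, ExtZero B V (Costd k e m) 1)
    (hhead : ∀ (U : Submodule B V), IsSimpleModule B (V ⧸ U) → ∀ m < l, ∀ y : V ⧸ U, e m • y = 0)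
    (hN : ∀ m, ¬ m < l → ∀ x : N, e m • x = 0) : ExtZero B V N 1 := by
  have hfl := isFiniteLength_of_finite (B := B) N
  induction hfl with
  | of_subsingleton => exact ExtZero.of_subsingleton_right _
  | @of_simple_quotient M _ _ N' _ _ ih =>
    refine (isSES_subtype_mkQ N').extZero_mid' (ih fun m hm x => Subtype.ext (hN m hm x)) ?_
    obtain ⟨m, x, hx⟩ := (h.weights.complete (ModuleCat.of B (M ⧸ N')) inferInstance).exists
    obtain ⟨j, hj, hw⟩ := h.exists_costd_injective (S := M ⧸ N') hx
    have hml : m < l := by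
      by_contra hc
      obtain ⟨y, rfl⟩ := Submodule.mkQ_surjective _ x
      apply hx
      rw [← map_smul, hN m hc, map_zero]
    have hs : IsSES j (LinearMap.range j).mkQ :=
      ⟨hj, Submodule.mkQ_surjective _, LinearMap.exact_map_mkQ_range j⟩
    -- It remains to exclude maps from `V` to `∇(m) / L(m)`: a simple quotient of a nonzero image
    -- would be a simple quotient of `V` of weight `m' < m < l`.
    refine hs.extZero_left' (extZero_zero_iff.2 fun f => ?_) (hV m)
    by_contra hf
    have : Nontrivial (LinearMap.range f) :=
      Submodule.nontrivial_iff_ne_bot.2 fun hc => hf (LinearMap.range_eq_bot.1 hc)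
    obtain ⟨U, hU⟩ := IsCoatomic.exists_coatom (Submodule B (LinearMap.range f))
    have hUs : IsSimpleModule B (LinearMap.range f ⧸ U) := isSimpleModule_iff_isCoatom.2 hU
    let p : V →ₗ[B] (LinearMap.range f ⧸ U) := U.mkQ ∘ₗ f.rangeRestrict
    have hp : Function.Surjective p :=
      (Submodule.mkQ_surjective _).comp f.surjective_rangeRestrict
    let E := p.quotKerEquivOfSurjective hp
    have hVs : IsSimpleModule B (V ⧸ LinearMap.ker p) := IsSimpleModule.congr E
    obtain ⟨m', y, hy⟩ :=
      (h.weights.complete (ModuleCat.of B (LinearMap.range f ⧸ U)) inferInstance).exists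
    have hm' : m' < m := by
      by_contra hc
      obtain ⟨⟨z, hz⟩, rfl⟩ := Submodule.mkQ_surjective _ y
      obtain ⟨w, rfl⟩ := Submodule.mkQ_surjective _ z
      apply hy
      rw [← map_smul]
      have h0 : e m' • (LinearMap.range j).mkQ w = 0 := by
        rw [← map_smul, Submodule.mkQ_apply, Submodule.Quotient.mk_eq_zero]
        exact hw m' hc w
      have h1 : e m' • (⟨(LinearMap.range j).mkQ w, hz⟩ : LinearMap.range f) = 0 :=
        Subtype.ext h0
      rw [h1, map_zero]
    apply hy
    have := hhead _ hVs m' (hm'.trans hml) (E.symm y)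
    rw [← map_smul, LinearEquiv.map_eq_zero_iff] at this
    exact this

/-- A finite module `V` with `Ext^1(V, ∇(m)) = 0` for all `m` has a `Δ`-filtration. -/
theorem IsQuasiHereditary.hasStdFiltration_of_extZero [IsArtinianRing B]
    (h : IsQuasiHereditary k e) {V : Type u} [AddCommGroup V] [Module B V] [Module.Finite B V]
    (hV : ∀ m, ExtZero B V (Costd k e m) 1) : HasStdFiltration e V := by
  -- Passing to submodules of `V` allows induction on the submodule lattice; the kernels constructed
  -- below are moved into `V`.
  suffices H : ∀ W : Submodule B V, (∀ m, ExtZero B W (Costd k e m) 1) → HasStdFiltration e W from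
    (H ⊤ fun m => (hV m).congr_left Submodule.topEquiv.symm).congr Submodule.topEquiv
  intro W
  induction W using WellFoundedLT.induction with
  | ind W ih =>
  intro hW
  rcases subsingleton_or_nontrivial W with hsub | hnt
  · exact HasStdFiltration.of_subsingleton
  let Head : Set Λ := {m | ∃ U : Submodule B W, IsSimpleModule B (W ⧸ U) ∧
    ∃ y : W ⧸ U, e m • y ≠ 0}
  have hfin : Head.Finite := by
    refine (finite_weights h.idem h.weights (isFiniteLength_of_finite (B := B) W)).subset ?_
    rintro m ⟨U, -, y, hy⟩
    obtain ⟨z, rfl⟩ := Submodule.mkQ_surjective _ y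
    exact ⟨z, fun hc => hy (by rw [← map_smul, hc, map_zero])⟩
  have hne : Head.Nonempty := by
    obtain ⟨U, hU⟩ := IsCoatomic.exists_coatom (Submodule B W)
    have hUs : IsSimpleModule B (W ⧸ U) := isSimpleModule_iff_isCoatom.2 hU
    obtain ⟨m, x, hx⟩ := (h.weights.complete (ModuleCat.of B (W ⧸ U)) inferInstance).exists
    exact ⟨m, U, hUs, x, hx⟩
  -- Minimality of `l` in the head makes `Ext^1(W, ker q) = 0`, because `ker q` has weights `< l`.
  -- The quotient map `W → L(l)` therefore lifts to `W → Δ(l)`.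
  obtain ⟨l, ⟨U, hUs, x, hx⟩, hmin⟩ := hfin.exists_minimal hne
  obtain ⟨q, hq, hq0, hw⟩ := h.exists_std_surjective (S := W ⧸ U) hx
  have := std_finite (e := e) l
  have hext : ExtZero B W (LinearMap.ker q) 1 := by
    refine h.extZero_one_of_head (l := l) hW (fun U' hU' m hm y => ?_) fun m hm y =>
      Subtype.ext (hw m hm y.1 y.2)
    by_contra hc
    exact (lt_irrefl l) (lt_of_le_of_lt (hmin ⟨U', hU', y, hc⟩ hm.le) hm)
  obtain ⟨a, ha⟩ := (isSES_ker hq).exists_lift hext U.mkQ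
  have hasurj : Function.Surjective a := by
    rw [← LinearMap.range_eq_top, eq_top_iff]
    obtain ⟨w, hw'⟩ := Submodule.mkQ_surjective U (q (stdGen e l))
    -- As `ker q` lacks the weight `l`, applying `e l` to this difference gives zero, so `e l • w`
    -- maps to the generator.
    have h1 : stdGen e l - a w ∈ LinearMap.ker q := by
      rw [LinearMap.mem_ker, map_sub, ← LinearMap.comp_apply, ha, hw', sub_self]
    have h2 := hw l (lt_irrefl l) _ h1
    rw [smul_sub, smul_stdGen (h.idem l), sub_eq_zero] at h2
    intro z _
    obtain ⟨b, rfl⟩ := exists_smul_stdGen l z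
    exact ⟨b • e l • w, by rw [map_smul, map_smul, ← h2]⟩
  have hs := isSES_ker hasurj
  let E := Submodule.equivMapOfInjective W.subtype W.injective_subtype (LinearMap.ker a)
  have hlt : (LinearMap.ker a).map W.subtype < W := by
    refine lt_of_le_of_ne (Submodule.map_subtype_le _ _) fun hc => ?_
    obtain ⟨w, hw'⟩ := hasurj (stdGen e l)
    have hwm : (w : V) ∈ (LinearMap.ker a).map W.subtype := by rw [hc]; exact w.2
    obtain ⟨w', hw1, hw2⟩ := hwm
    rw [Subtype.ext hw2] at hw1
    exact (h.exists_smul_eq l).1 (hw'.symm.trans hw1)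
  have hk : HasStdFiltration e (LinearMap.ker a) := by
    refine (ih _ hlt fun m => ?_).congr E.symm
    exact (hs.extZero_left (hW m) (h.extZero_std_costd 1 l m)).congr_left E
  exact HasStdFiltration.of_ses hs hk

end Homological

/-! ### Graded modules -/

section GradedModules

variable {k A : Type u} [Field k] [Ring A] [Algebra k A] {𝒜 : ℕ → Submodule k A}

theorem GrMod.induction (M : GrMod 𝒜) {p : M.carrier → Prop}
    (mem : ∀ j, ∀ x ∈ M.deg j, p x) (add : ∀ x y, p x → p y → p (x + y)) (x : M.carrier) : p x :=
  AddSubgroup.iSup_induction M.deg (C := p) (x := x) (by rw [M.iSup_eq_top]; trivial) mem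
    (mem 0 0 (zero_mem _)) add

theorem GrMod.isInternal (M : GrMod 𝒜) : DirectSum.IsInternal M.deg := by
  refine ⟨M.indep.dfinsuppSumAddHom_injective, fun x => ?_⟩
  induction x using M.induction with
  | mem i x hx =>
    exact ⟨DirectSum.of (fun i => M.deg i) i ⟨x, hx⟩, DirectSum.coeAddMonoidHom_of _ _ _⟩
  | add x y hx hy =>
    obtain ⟨a, rfl⟩ := hx
    obtain ⟨b, rfl⟩ := hy
    exact ⟨a + b, map_add _ _ _⟩

noncomputable instance (M : GrMod 𝒜) : DirectSum.Decomposition M.deg :=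
  M.isInternal.chooseDecomposition

/-- The projection of a graded module to its grade `j` part. -/
noncomputable def GrMod.proj (M : GrMod 𝒜) (j : ℤ) : M.carrier →+ M.carrier where
  toFun x := DirectSum.decompose M.deg x j
  map_zero' := by rw [DirectSum.decompose_zero]; rfl
  map_add' x y := by rw [DirectSum.decompose_add]; rfl

theorem GrMod.proj_mem (M : GrMod 𝒜) (j : ℤ) (x : M.carrier) : M.proj j x ∈ M.deg j :=
  (DirectSum.decompose M.deg x j).2

theorem GrMod.proj_of_mem (M : GrMod 𝒜) {j : ℤ} {x : M.carrier} (hx : x ∈ M.deg j) :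
    M.proj j x = x :=
  DirectSum.decompose_of_mem_same M.deg hx

theorem GrMod.proj_of_mem_ne (M : GrMod 𝒜) {i j : ℤ} (hij : i ≠ j) {x : M.carrier}
    (hx : x ∈ M.deg i) : M.proj j x = 0 :=
  DirectSum.decompose_of_mem_ne M.deg hx hij

theorem GrMod.exists_sum_proj (M : GrMod 𝒜) (x : M.carrier) :
    ∃ s : Finset ℤ, x = ∑ j ∈ s, M.proj j x := by
  classical
  exact ⟨_, (DirectSum.sum_support_decompose M.deg x).symm⟩

theorem grHom_proj {M N : GrMod 𝒜} {f : M.carrier →ₗ[A] N.carrier} (hf : f ∈ grHom M N) (j : ℤ)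
    (x : M.carrier) : f (M.proj j x) = N.proj j (f x) := by
  induction x using M.induction with
  | mem i x hx =>
    by_cases hij : i = j
    · subst hij
      rw [M.proj_of_mem hx, N.proj_of_mem (hf i x hx)]
    · rw [M.proj_of_mem_ne hij hx, N.proj_of_mem_ne hij (hf i x hx), map_zero]
  | add x y hx hy => simp only [map_add, hx, hy]

theorem grHom_id (M : GrMod 𝒜) : LinearMap.id ∈ grHom M M := fun _ _ h => h

theorem grHom_comp {M N L : GrMod 𝒜} {f : M.carrier →ₗ[A] N.carrier}
    {g : N.carrier →ₗ[A] L.carrier}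
    (hg : g ∈ grHom N L) (hf : f ∈ grHom M N) : g ∘ₗ f ∈ grHom M L :=
  fun j x hx => hg j _ (hf j x hx)

/-- Homogeneous elements of the preimage. -/
theorem grHom_exists_of_mem {M N : GrMod 𝒜} {f : M.carrier →ₗ[A] N.carrier} (hf : f ∈ grHom M N)
    (hs : Function.Surjective f) {j : ℤ} {y : N.carrier} (hy : y ∈ N.deg j) :
    ∃ x ∈ M.deg j, f x = y := by
  obtain ⟨x, rfl⟩ := hs y
  exact ⟨M.proj j x, M.proj_mem j x, by rw [grHom_proj hf, N.proj_of_mem hy]⟩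

/-- An element of grade `i` that is a sum of elements of other grades is both fixed and killed by `p
i`. -/
theorem iSupIndep_of_proj {X : Type*} [AddCommGroup X] {deg : ℤ → AddSubgroup X} (p : ℤ → X →+ X)
    (h₁ : ∀ j, ∀ x ∈ deg j, p j x = x) (h₂ : ∀ i j, i ≠ j → ∀ x ∈ deg i, p j x = 0) :
    iSupIndep deg := by
  intro i
  rw [disjoint_iff, eq_bot_iff]
  rintro x ⟨hx, hx'⟩
  have h : (⨆ j, ⨆ (_ : j ≠ i), deg j) ≤ (p i).ker :=
    iSup_le fun j => iSup_le fun hj x hx => h₂ j i hj x hx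
  rw [AddSubgroup.mem_bot, ← h₁ i x hx]
  exact h hx'

/-- The graded submodule given by a homogeneous submodule. -/
def GrMod.sub (M : GrMod 𝒜) (S : Submodule A M.carrier) (hS : ∀ x ∈ S, ∀ j, M.proj j x ∈ S) :
    GrMod 𝒜 where
  carrier := S
  deg j := (M.deg j).comap (S.subtype : S →+ M.carrier)
  indep := by
    refine iSupIndep_of_proj (fun j => ((M.proj j).comp (S.subtype : S →+ M.carrier)).codRestrict S
      fun x => hS x.1 x.2 j) ?_ ?_
    · exact fun j x hx => Subtype.ext (M.proj_of_mem hx)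
    · exact fun i j hij x hx => Subtype.ext (M.proj_of_mem_ne hij hx)
  iSup_eq_top := by
    rw [eq_top_iff]
    rintro x -
    obtain ⟨s, hs⟩ := M.exists_sum_proj x.1
    have : x = ∑ j ∈ s, (⟨M.proj j x.1, hS x.1 x.2 j⟩ : S) := by
      apply Subtype.ext
      rw [AddSubmonoidClass.coe_finsetSum]
      exact hs
    rw [this]
    refine sum_mem fun j _ => ?_
    exact AddSubgroup.mem_iSup_of_mem j (M.proj_mem j x.1)
  smul_mem i j a x ha hx := M.smul_mem i j a x.1 ha hx

theorem GrMod.sub_subtype_mem (M : GrMod 𝒜) (S : Submodule A M.carrier)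
    (hS : ∀ x ∈ S, ∀ j, M.proj j x ∈ S) : S.subtype ∈ grHom (M.sub S hS) M := fun _ _ h => h

/-- The graded quotient module by a homogeneous submodule. -/
def GrMod.quot (M : GrMod 𝒜) (S : Submodule A M.carrier) (hS : ∀ x ∈ S, ∀ j, M.proj j x ∈ S) :
    GrMod 𝒜 where
  carrier := M.carrier ⧸ S
  deg j := (M.deg j).map (S.mkQ : M.carrier →+ M.carrier ⧸ S)
  indep := by
    have hk : ∀ j, ∀ x ∈ S.toAddSubgroup,
        ((S.mkQ : M.carrier →+ M.carrier ⧸ S).comp (M.proj j)) x = 0 := by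
      intro j x hx
      exact (Submodule.Quotient.mk_eq_zero S).2 (hS x hx j)
    refine iSupIndep_of_proj (fun j => QuotientAddGroup.lift S.toAddSubgroup _ (hk j)) ?_ ?_
    · rintro j _ ⟨x, hx, rfl⟩
      exact congrArg S.mkQ (M.proj_of_mem hx)
    · rintro i j hij _ ⟨x, hx, rfl⟩
      exact (congrArg S.mkQ (M.proj_of_mem_ne hij hx)).trans (map_zero _)
  iSup_eq_top := by
    rw [← AddSubgroup.map_iSup, M.iSup_eq_top, ← AddMonoidHom.range_eq_map,
      AddMonoidHom.range_eq_top]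
    exact S.mkQ_surjective
  smul_mem := by
    rintro i j a _ ha ⟨x, hx, rfl⟩
    exact ⟨a • x, M.smul_mem i j a x ha hx, rfl⟩

/-- The direct sum of two graded modules. -/
def GrMod.prod (M N : GrMod 𝒜) : GrMod 𝒜 where
  carrier := M.carrier × N.carrier
  deg j := (M.deg j).prod (N.deg j)
  indep := by
    refine iSupIndep_of_proj (fun j => (M.proj j).prodMap (N.proj j)) ?_ ?_
    · exact fun j x hx => Prod.ext (M.proj_of_mem hx.1) (N.proj_of_mem hx.2)
    · exact fun i j hij x hx => Prod.ext (M.proj_of_mem_ne hij hx.1) (N.proj_of_mem_ne hij hx.2)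
  iSup_eq_top := by
    rw [eq_top_iff]
    rintro ⟨x, y⟩ -
    have h₁ : ∀ x : M.carrier, ((x, 0) : M.carrier × N.carrier) ∈
        ⨆ j, (M.deg j).prod (N.deg j) := by
      intro x
      induction x using M.induction with
      | mem j x hx => exact AddSubgroup.mem_iSup_of_mem j ⟨hx, zero_mem _⟩
      | add x y hx hy => simpa using add_mem hx hy
    have h₂ : ∀ x : N.carrier, ((0, x) : M.carrier × N.carrier) ∈
        ⨆ j, (M.deg j).prod (N.deg j) := by
      intro x
      induction x using N.induction with
      | mem j x hx => exact AddSubgroup.mem_iSup_of_mem j ⟨zero_mem _, hx⟩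
      | add x y hx hy => simpa using add_mem hx hy
    simpa using add_mem (h₁ x) (h₂ y)
  smul_mem i j a x ha hx := ⟨M.smul_mem i j a x.1 ha hx.1, N.smul_mem i j a x.2 ha hx.2⟩

/-- The direct sum of a family of graded modules. -/
noncomputable def GrMod.directSum {ι : Type u} (P : ι → GrMod 𝒜) : GrMod 𝒜 where
  carrier := Π₀ i, (P i).carrier
  deg j :=
    { carrier := {f | ∀ i, f i ∈ (P i).deg j}
      zero_mem' := fun i => zero_mem _
      add_mem' := fun hf hg i => add_mem (hf i) (hg i)
      neg_mem' := fun hf i => neg_mem (hf i) }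
  indep := by
    refine iSupIndep_of_proj (fun j => DFinsupp.mapRange.addMonoidHom fun i => (P i).proj j) ?_ ?_
    · exact fun j x hx => DFinsupp.ext fun i => (P i).proj_of_mem (hx i)
    · exact fun i j hij x hx => DFinsupp.ext fun l => (P l).proj_of_mem_ne hij (hx l)
  iSup_eq_top := by
    classical
    rw [eq_top_iff]
    rintro f -
    induction f using DFinsupp.induction with
    | h0 => exact zero_mem _
    | ha i b f h₁ h₂ hf =>
      clear h₁ h₂
      refine add_mem ?_ hf
      induction b using (P i).induction with
      | mem j x hx =>
        refine AddSubgroup.mem_iSup_of_mem j fun l => ?_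
        by_cases hl : i = l
        · subst hl
          rwa [DFinsupp.single_eq_same]
        · rw [DFinsupp.single_eq_of_ne (Ne.symm hl)]
          exact zero_mem _
      | add x y hx hy => rw [DFinsupp.single_add]; exact add_mem hx hy
  smul_mem i j a x ha hx l := (P l).smul_mem i j a (x l) ha (hx l)

end GradedModules

/-! ### Graded homomorphisms, kernels and free covers -/

section GradedHoms

variable {k A : Type u} [Field k] [Ring A] [Algebra k A] {𝒜 : ℕ → Submodule k A}
  [GradedAlgebra 𝒜]

theorem GrMod.proj_smul (M : GrMod 𝒜) {i : ℕ} {a : A} (ha : a ∈ 𝒜 i) (j : ℤ) (x : M.carrier) :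
    M.proj j (a • x) = a • M.proj (j - i) x := by
  induction x using M.induction with
  | mem l x hx =>
    have h := M.smul_mem i l a x ha hx
    by_cases hl : (i : ℤ) + l = j
    · subst hl
      rw [M.proj_of_mem h, add_sub_cancel_left, M.proj_of_mem hx]
    · rw [M.proj_of_mem_ne hl h, M.proj_of_mem_ne (by omega) hx, smul_zero]
  | add x y hx hy => simp only [smul_add, map_add, hx, hy]

/-- Additive maps between `A`-modules that are linear for homogeneous elements are linear. -/
def linearOfHomogeneous (𝒜 : ℕ → Submodule k A) [GradedAlgebra 𝒜] {M N : Type*} [AddCommGroup M]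
    [Module A M] [AddCommGroup N] [Module A N] (f : M →+ N)
    (hf : ∀ i, ∀ a ∈ 𝒜 i, ∀ x, f (a • x) = a • f x) : M →ₗ[A] N where
  toFun := f
  map_add' := map_add f
  map_smul' a x := by
    induction a using DirectSum.Decomposition.inductionOn 𝒜 with
    | zero => simp
    | homogeneous a => exact hf _ a.1 a.2 x
    | add a b ha hb =>
      simp only [RingHom.id_apply] at ha hb ⊢
      rw [add_smul, map_add, ha, hb, add_smul]

/-- The degree zero component of a homomorphism between graded modules, as an additive map. -/
noncomputable def degZeroAux {M N : GrMod 𝒜} (f : M.carrier →ₗ[A] N.carrier) :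
    M.carrier →+ N.carrier :=
  (DirectSum.toAddMonoid fun j : ℤ =>
    ((N.proj j).comp (f : M.carrier →+ N.carrier)).comp (M.deg j).subtype).comp
      (DirectSum.decomposeAddEquiv M.deg).toAddMonoidHom

theorem degZeroAux_of_mem {M N : GrMod 𝒜} (f : M.carrier →ₗ[A] N.carrier) {j : ℤ} {x : M.carrier}
    (hx : x ∈ M.deg j) : degZeroAux f x = N.proj j (f x) := by
  change DirectSum.toAddMonoid _ (DirectSum.decompose M.deg x) = _
  rw [DirectSum.decompose_of_mem M.deg hx, DirectSum.toAddMonoid_of]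
  rfl

/-- The degree zero component of a homomorphism between graded modules. -/
noncomputable def degZero {M N : GrMod 𝒜} (f : M.carrier →ₗ[A] N.carrier) :
    M.carrier →ₗ[A] N.carrier :=
  linearOfHomogeneous 𝒜 (degZeroAux f) fun i a ha x => by
    induction x using M.induction with
    | mem j x hx =>
      rw [degZeroAux_of_mem f (M.smul_mem i j a x ha hx), degZeroAux_of_mem f hx, map_smul,
        N.proj_smul ha, add_sub_cancel_left]
    | add x y hx hy => simp only [smul_add, map_add, hx, hy]

theorem degZero_of_mem {M N : GrMod 𝒜} (f : M.carrier →ₗ[A] N.carrier) {j : ℤ} {x : M.carrier}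
    (hx : x ∈ M.deg j) : degZero f x = N.proj j (f x) := degZeroAux_of_mem f hx

theorem degZero_mem {M N : GrMod 𝒜} (f : M.carrier →ₗ[A] N.carrier) : degZero f ∈ grHom M N := by
  intro j x hx
  rw [degZero_of_mem f hx]
  exact N.proj_mem _ _

theorem degZero_eq_self {M N : GrMod 𝒜} {f : M.carrier →ₗ[A] N.carrier} (hf : f ∈ grHom M N) :
    degZero f = f := by
  refine LinearMap.ext fun x => ?_
  induction x using M.induction with
  | mem j x hx => rw [degZero_of_mem f hx, N.proj_of_mem (hf j x hx)]
  | add x y hx hy => rw [map_add, map_add, hx, hy]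

/-- Composition with a graded map commutes with taking degree zero components. Hence ungraded
factorizations of graded maps can be replaced by graded ones. -/
theorem degZero_comp_right {L M N : GrMod 𝒜} (f : M.carrier →ₗ[A] N.carrier)
    {g : L.carrier →ₗ[A] M.carrier} (hg : g ∈ grHom L M) : degZero (f ∘ₗ g) = degZero f ∘ₗ g := by
  refine LinearMap.ext fun x => ?_
  induction x using L.induction with
  | mem j x hx =>
    rw [degZero_of_mem _ hx, LinearMap.comp_apply, LinearMap.comp_apply,
      degZero_of_mem f (hg j x hx)]
  | add x y hx hy => rw [map_add, map_add, hx, hy]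

theorem degZero_comp_left {L M N : GrMod 𝒜} {f : M.carrier →ₗ[A] N.carrier} (hf : f ∈ grHom M N)
    (g : L.carrier →ₗ[A] M.carrier) : degZero (f ∘ₗ g) = f ∘ₗ degZero g := by
  refine LinearMap.ext fun x => ?_
  induction x using L.induction with
  | mem j x hx =>
    rw [degZero_of_mem _ hx, LinearMap.comp_apply, LinearMap.comp_apply,
      degZero_of_mem g hx, grHom_proj hf]
  | add x y hx hy => rw [map_add, map_add, hx, hy]

/-- Graded modules that are projective as modules have the lifting property for graded
homomorphisms. -/
theorem grHom_exists_lift {P E M : GrMod 𝒜} [Module.Projective A P.carrier]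
    {g : E.carrier →ₗ[A] M.carrier} (hg : g ∈ grHom E M) (hs : Function.Surjective g)
    {f : P.carrier →ₗ[A] M.carrier} (hf : f ∈ grHom P M) :
    ∃ h ∈ grHom P E, g ∘ₗ h = f := by
  obtain ⟨h, hh⟩ := Module.projective_lifting_property g f hs
  exact ⟨degZero h, degZero_mem h, by rw [← degZero_comp_left hg, hh, degZero_eq_self hf]⟩

/-- If a graded homomorphism factors through a graded homomorphism `f`, then it factors
through `f` by a graded homomorphism. -/
theorem grHom_exists_extend {K P N : GrMod 𝒜} {f : K.carrier →ₗ[A] P.carrier} (hf : f ∈ grHom K P)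
    {h : K.carrier →ₗ[A] N.carrier} (hh : h ∈ grHom K N)
    (H : ∃ b : P.carrier →ₗ[A] N.carrier, b ∘ₗ f = h) : ∃ b ∈ grHom P N, b ∘ₗ f = h := by
  obtain ⟨b, rfl⟩ := H
  exact ⟨degZero b, degZero_mem b, by rw [← degZero_comp_right b hf, degZero_eq_self hh]⟩

/-- The kernel of a graded homomorphism. -/
noncomputable def grKer {M N : GrMod 𝒜} {f : M.carrier →ₗ[A] N.carrier} (hf : f ∈ grHom M N) :
    GrMod 𝒜 :=
  M.sub (LinearMap.ker f) fun x hx j => by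
    rw [LinearMap.mem_ker, grHom_proj hf, LinearMap.mem_ker.1 hx, map_zero]

/-- Short exact sequences of graded modules. -/
structure IsGrSES {K E M : GrMod 𝒜} (f : K.carrier →ₗ[A] E.carrier)
    (g : E.carrier →ₗ[A] M.carrier) : Prop extends IsSES f g where
  left_mem : f ∈ grHom K E
  right_mem : g ∈ grHom E M

theorem isGrSES_ker {M N : GrMod 𝒜} {f : M.carrier →ₗ[A] N.carrier} (hf : f ∈ grHom M N)
    (hs : Function.Surjective f) : IsGrSES (K := grKer hf) (LinearMap.ker f).subtype f where
  toIsSES := isSES_ker hs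
  left_mem := GrMod.sub_subtype_mem _ _ _
  right_mem := hf

/-- Every surjective graded homomorphism has a graded kernel. -/
theorem exists_isGrSES {M N : GrMod 𝒜} {f : M.carrier →ₗ[A] N.carrier} (hf : f ∈ grHom M N)
    (hs : Function.Surjective f) : ∃ (K : GrMod 𝒜) (i : K.carrier →ₗ[A] M.carrier), IsGrSES i f :=
  ⟨_, _, isGrSES_ker hf hs⟩

/-- The direct sum of two graded modules, with its structure maps. -/
theorem GrMod.exists_prod (M N : GrMod 𝒜) :
    ∃ (P : GrMod 𝒜) (i : M.carrier →ₗ[A] P.carrier) (j : N.carrier →ₗ[A] P.carrier)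
      (r : P.carrier →ₗ[A] M.carrier) (t : P.carrier →ₗ[A] N.carrier),
      (i ∈ grHom M P ∧ j ∈ grHom N P ∧ r ∈ grHom P M ∧ t ∈ grHom P N) ∧
      ((∀ x, r (i x) = x) ∧ (∀ y, t (j y) = y) ∧ (∀ x, t (i x) = 0) ∧ (∀ y, r (j y) = 0) ∧
        ∀ z, i (r z) + j (t z) = z) ∧
      (Module.Projective A M.carrier → Module.Projective A N.carrier →
        Module.Projective A P.carrier) :=
  ⟨M.prod N, LinearMap.inl A M.carrier N.carrier, LinearMap.inr A M.carrier N.carrier,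
    LinearMap.fst A M.carrier N.carrier, LinearMap.snd A M.carrier N.carrier,
    ⟨fun _ _ h => ⟨h, zero_mem _⟩, fun _ _ h => ⟨zero_mem _, h⟩, fun _ _ h => h.1,
      fun _ _ h => h.2⟩,
    ⟨fun _ => rfl, fun _ => rfl, fun _ => rfl, fun _ => rfl, fun z =>
      Prod.ext (add_zero (Prod.fst z)) (zero_add (Prod.snd z))⟩,
    fun _ _ => inferInstanceAs (Module.Projective A (M.carrier × N.carrier))⟩

/-- The shift of a graded module, with the comparison isomorphism. -/
theorem GrMod.exists_shift (M : GrMod 𝒜) (r : ℤ) :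
    ∃ (L : GrMod 𝒜) (φ : M.carrier ≃ₗ[A] L.carrier), ∀ j x, x ∈ M.deg j ↔ φ x ∈ L.deg (j + r) :=
  ⟨M.shift r, LinearEquiv.refl A M.carrier, fun j x => by
    change x ∈ M.deg j ↔ x ∈ M.deg (j + r - r)
    rw [add_sub_cancel_right]⟩

/-- An injective graded map reflects grades, because it commutes with the projections. -/
theorem IsGrSES.mem_of_left {K E M : GrMod 𝒜} {f : K.carrier →ₗ[A] E.carrier}
    {g : E.carrier →ₗ[A] M.carrier} (h : IsGrSES f g) {j : ℤ} {x : K.carrier}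
    (hx : f x ∈ E.deg j) : x ∈ K.deg j := by
  have : K.proj j x = x := h.inj (by rw [grHom_proj h.left_mem, E.proj_of_mem hx])
  rw [← this]
  exact K.proj_mem j x

/-- A homomorphism of graded modules that is killed by `g` factors through the kernel `f`. -/
theorem IsGrSES.exists_factor {K E M L : GrMod 𝒜} {f : K.carrier →ₗ[A] E.carrier}
    {g : E.carrier →ₗ[A] M.carrier} (h : IsGrSES f g) {a : L.carrier →ₗ[A] E.carrier}
    (ha : a ∈ grHom L E) (hga : g ∘ₗ a = 0) : ∃ b ∈ grHom L K, f ∘ₗ b = a := by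
  have hr : ∀ x, a x ∈ LinearMap.range f := fun x => (h.exact _).1 (LinearMap.congr_fun hga x)
  let E' := LinearEquiv.ofInjective f h.inj
  have hb : f ∘ₗ (E'.symm.toLinearMap ∘ₗ a.codRestrict _ hr) = a := by
    refine LinearMap.ext fun x => ?_
    exact congrArg Subtype.val (E'.apply_symm_apply ⟨a x, hr x⟩)
  refine ⟨_, fun j x hx => h.mem_of_left ?_, hb⟩
  rw [← LinearMap.comp_apply, hb]
  exact ha j x hx

/-- A homomorphism of graded modules that vanishes on the kernel `f` of `g` factors
through `g`. -/
theorem IsGrSES.exists_factor' {K E M L : GrMod 𝒜} {f : K.carrier →ₗ[A] E.carrier}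
    {g : E.carrier →ₗ[A] M.carrier} (h : IsGrSES f g) {a : E.carrier →ₗ[A] L.carrier}
    (ha : a ∈ grHom E L) (haf : a ∘ₗ f = 0) : ∃ b ∈ grHom M L, b ∘ₗ g = a := by
  have hk : LinearMap.ker g ≤ LinearMap.ker a := by
    intro x hx
    obtain ⟨y, rfl⟩ := (h.exact x).1 hx
    exact LinearMap.congr_fun haf y
  let E' := g.quotKerEquivOfSurjective h.surj
  have hb : ((LinearMap.ker g).liftQ a hk ∘ₗ E'.symm.toLinearMap) ∘ₗ g = a := by
    refine LinearMap.ext fun x => ?_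
    have : E'.symm (g x) = (LinearMap.ker g).mkQ x := by
      rw [LinearEquiv.symm_apply_eq]; rfl
    rw [LinearMap.comp_apply, LinearMap.comp_apply, LinearEquiv.coe_coe, this]
    rfl
  refine ⟨_, fun j y hy => ?_, hb⟩
  obtain ⟨x, hx, rfl⟩ := grHom_exists_of_mem h.right_mem h.surj hy
  rw [← LinearMap.comp_apply, hb]
  exact ha j x hx

/-- The grade `j` part of `A`, for an integer `j`. -/
def regularDeg (𝒜 : ℕ → Submodule k A) : ℤ → AddSubgroup A
  | Int.ofNat i => (𝒜 i).toAddSubgroup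
  | Int.negSucc _ => ⊥

theorem eq_zero_of_mem_regularDeg {j : ℤ} (hj : j < 0) {x : A} (hx : x ∈ regularDeg 𝒜 j) :
    x = 0 := by
  obtain ⟨i, rfl⟩ := Int.eq_negSucc_of_lt_zero hj
  exact hx

/-- The algebra `A` as a graded module. -/
noncomputable def regular (𝒜 : ℕ → Submodule k A) [GradedAlgebra 𝒜] : GrMod 𝒜 where
  carrier := A
  deg := regularDeg 𝒜
  indep := by
    refine iSupIndep_of_proj (fun j => if 0 ≤ j then GradedRing.proj 𝒜 j.toNat else 0) ?_ ?_
    · rintro (i | i) x hx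
      · exact DirectSum.decompose_of_mem_same 𝒜 hx
      · rw [AddSubgroup.mem_bot.1 hx, map_zero]
    · rintro (i | i) j hij x hx
      · by_cases hj : 0 ≤ j
        · rw [if_pos hj]
          exact DirectSum.decompose_of_mem_ne 𝒜 hx fun h => hij (by
            rw [h]; exact Int.toNat_of_nonneg hj)
        · rw [if_neg hj]
          rfl
      · rw [AddSubgroup.mem_bot.1 hx, map_zero]
  iSup_eq_top := by
    rw [eq_top_iff]
    rintro x -
    induction x using DirectSum.Decomposition.inductionOn 𝒜 with
    | zero => exact zero_mem _
    | @homogeneous i a => exact AddSubgroup.mem_iSup_of_mem (i : ℤ) a.2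
    | add a b ha hb => exact add_mem ha hb
  smul_mem := by
    rintro i (j | j) a x ha hx
    · exact SetLike.GradedMul.mul_mem (A := 𝒜) ha hx
    · rw [AddSubgroup.mem_bot.1 hx, smul_zero]
      exact zero_mem _

theorem GrMod.smul_mem_of_regular (M : GrMod 𝒜) {i j : ℤ} {a : A} {x : M.carrier}
    (ha : a ∈ regularDeg 𝒜 i) (hx : x ∈ M.deg j) : a • x ∈ M.deg (i + j) := by
  rcases lt_or_ge i 0 with hi | hi
  · rw [eq_zero_of_mem_regularDeg hi ha, zero_smul]
    exact zero_mem _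
  · obtain ⟨n, rfl⟩ := Int.eq_ofNat_of_zero_le hi
    exact M.smul_mem n j a x ha hx

/-- The free graded module on the homogeneous elements of `M` with degrees in `T`. -/
noncomputable def GrMod.cover (M : GrMod 𝒜) (T : Set ℤ) : GrMod 𝒜 :=
  GrMod.directSum fun i : Σ j : T, M.deg j => (regular 𝒜).shift i.1

instance (M : GrMod 𝒜) (T : Set ℤ) : Module.Projective A (M.cover T).carrier :=
  inferInstanceAs (Module.Projective A (Π₀ _ : Σ j : T, M.deg j, A))

open Classical in
/-- The canonical map from the free graded module on homogeneous elements of `M` to `M`. -/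
noncomputable def GrMod.coverMap (M : GrMod 𝒜) (T : Set ℤ) :
    (M.cover T).carrier →ₗ[A] M.carrier :=
  DFinsupp.lsum ℕ fun i : Σ j : T, M.deg j =>
    LinearMap.toSpanSingleton A M.carrier (i.2 : M.carrier)

theorem GrMod.coverMap_mem (M : GrMod 𝒜) (T : Set ℤ) : M.coverMap T ∈ grHom (M.cover T) M := by
  classical
  intro j f hf
  refine dfinsuppSumAddHom_mem (M.deg j) f _ fun i _ => ?_
  have := M.smul_mem_of_regular (hf i) i.2.2
  rwa [sub_add_cancel] at this

theorem GrMod.coverMap_surjective (M : GrMod 𝒜) (T : Set ℤ) (hT : ∀ j ∉ T, M.deg j = ⊥) :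
    Function.Surjective (M.coverMap T) := by
  classical
  intro x
  induction x using M.induction with
  | mem j x hx =>
    by_cases hj : j ∈ T
    · let i : Σ j : T, M.deg j := ⟨⟨j, hj⟩, ⟨x, hx⟩⟩
      refine ⟨(DFinsupp.single i (1 : A) : Π₀ _ : Σ j : T, M.deg j, A), ?_⟩
      exact (DFinsupp.lsum_single ℕ (M := fun _ : Σ j : T, M.deg j => A) _ i 1).trans (one_smul A x)
    · rw [hT j hj, AddSubgroup.mem_bot] at hx
      exact ⟨0, by rw [hx, map_zero]⟩
  | add x y hx hy =>
    obtain ⟨a, rfl⟩ := hx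
    obtain ⟨b, rfl⟩ := hy
    exact ⟨a + b, map_add _ _ _⟩

/-- With generators in grades `≥ s` and `A` non-negatively graded, nothing appears below `s`. This
is why the cover carries the parameter `T`. -/
theorem GrMod.cover_deg_eq_bot (M : GrMod 𝒜) {T : Set ℤ} {s : ℤ} (hT : ∀ j ∈ T, s ≤ j) {j : ℤ}
    (hj : j < s) : (M.cover T).deg j = ⊥ := by
  rw [eq_bot_iff]
  intro f hf
  refine DFinsupp.ext fun i => ?_
  exact eq_zero_of_mem_regularDeg (A := A) (𝒜 := 𝒜) (j := j - i.1)
    (by have := hT _ i.1.2; omega) (hf i)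

/-- Every graded module has a projective presentation. -/
theorem GrMod.exists_presentation (M : GrMod 𝒜) :
    ∃ (K P : GrMod 𝒜) (f : K.carrier →ₗ[A] P.carrier) (g : P.carrier →ₗ[A] M.carrier),
      IsGrSES f g ∧ Module.Projective A P.carrier :=
  ⟨_, M.cover Set.univ, _, _,
    isGrSES_ker (M.coverMap_mem Set.univ) (M.coverMap_surjective _ fun _ hj => absurd trivial hj),
    inferInstance⟩

end GradedHoms

/-! ### Vanishing of graded Ext groups -/

section GradedExt

variable {k A : Type u} [Field k] [Ring A] [Algebra k A] {𝒜 : ℕ → Submodule k A}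
  [GradedAlgebra 𝒜]

/-- `ext^{i+1}(M, N) = 0` for graded modules. -/
def GrExtVanish : ℕ → GrMod 𝒜 → GrMod 𝒜 → Prop
  | 0, M, N => ∀ (K P : GrMod 𝒜) (f : K.carrier →ₗ[A] P.carrier) (g : P.carrier →ₗ[A] M.carrier),
      IsGrSES f g → Module.Projective A P.carrier →
        ∀ h ∈ grHom K N, ∃ b ∈ grHom P N, b ∘ₗ f = h
  | i + 1, M, N => ∀ (K P : GrMod 𝒜) (f : K.carrier →ₗ[A] P.carrier)
      (g : P.carrier →ₗ[A] M.carrier), IsGrSES f g → Module.Projective A P.carrier →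
        GrExtVanish i K N

/-- If all graded homomorphisms to `N` extend along one projective presentation of `M`, they
extend along all short exact sequences ending in `M`. -/
theorem IsGrSES.exists_extend_of_presentation {K₀ P₀ K E M N : GrMod 𝒜}
    {f₀ : K₀.carrier →ₗ[A] P₀.carrier} {g₀ : P₀.carrier →ₗ[A] M.carrier} (h₀ : IsGrSES f₀ g₀)
    [Module.Projective A P₀.carrier] (H : ∀ h ∈ grHom K₀ N, ∃ b ∈ grHom P₀ N, b ∘ₗ f₀ = h)
    {f : K.carrier →ₗ[A] E.carrier} {g : E.carrier →ₗ[A] M.carrier} (hs : IsGrSES f g) :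
    ∀ h ∈ grHom K N, ∃ b ∈ grHom E N, b ∘ₗ f = h := by
  intro h hh
  -- Compare the presentation with the given sequence by `φ : P₀ → E` and `ψ : K₀ → K`, and extend
  -- `h ∘ ψ` to `w : P₀ → N`.
  obtain ⟨φ, hφ, hφg⟩ := grHom_exists_lift hs.right_mem hs.surj h₀.right_mem
  obtain ⟨ψ, hψ, hψf⟩ := hs.exists_factor (grHom_comp hφ h₀.left_mem) (by
    rw [← LinearMap.comp_assoc, hφg]; exact h₀.exact.linearMap_comp_eq_zero)
  obtain ⟨w, hw, hwf⟩ := H _ (grHom_comp hh hψ)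
  -- `E` is the pushout of `K` and `P₀` over `K₀`: the map `K ⊕ P₀ → E` is onto with kernel the
  -- pairs `(-ψ q, f₀ q)`, and `(h, w)` vanishes on these.
  obtain ⟨Q, i, j, r, t, ⟨hi, hj, hr, ht⟩, ⟨hri, htj, hti, hrj, hrt⟩, -⟩ := K.exists_prod P₀
  have hsm : f ∘ₗ r + φ ∘ₗ t ∈ grHom Q E :=
    add_mem (grHom_comp hs.left_mem hr) (grHom_comp hφ ht)
  have hsurj : Function.Surjective (f ∘ₗ r + φ ∘ₗ t) := by
    intro x
    obtain ⟨p, hp⟩ := h₀.surj (g x)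
    obtain ⟨y, hy⟩ := (hs.exact (x - φ p)).1 (by
      rw [map_sub, ← LinearMap.comp_apply, hφg, hp, sub_self])
    refine ⟨i y + j p, ?_⟩
    simp [hri, hrj, hti, htj, hy]
  obtain ⟨L, a, hL⟩ := exists_isGrSES hsm hsurj
  obtain ⟨b, hb, hbs⟩ := hL.exists_factor' (add_mem (grHom_comp hh hr) (grHom_comp hw ht)) (by
    refine LinearMap.ext fun z => ?_
    have hxp' : f (r (a z)) + φ (t (a z)) = 0 := hL.exact.apply_apply_eq_zero z
    have hgp : g₀ (t (a z)) = 0 := by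
      have := congrArg g hxp'
      rwa [map_add, hs.exact.apply_apply_eq_zero, zero_add, map_zero, ← LinearMap.comp_apply,
        hφg] at this
    obtain ⟨q, hq⟩ := (h₀.exact _).1 hgp
    have hx : r (a z) = -ψ q := by
      apply hs.inj
      rw [map_neg, eq_neg_iff_add_eq_zero, ← hxp', ← hq]
      exact congrArg _ (LinearMap.congr_fun hψf q)
    change h (r (a z)) + w (t (a z)) = 0
    rw [hx, map_neg, neg_add_eq_zero, ← hq]
    exact (LinearMap.congr_fun hwf q).symm)
  refine ⟨b, hb, LinearMap.ext fun x => ?_⟩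
  have := LinearMap.congr_fun hbs (i x)
  simpa [hri, hti] using this

theorem GrExtVanish.exists_extend {K E M N : GrMod 𝒜} (hM : GrExtVanish 0 M N)
    {f : K.carrier →ₗ[A] E.carrier} {g : E.carrier →ₗ[A] M.carrier} (hs : IsGrSES f g) :
    ∀ h ∈ grHom K N, ∃ b ∈ grHom E N, b ∘ₗ f = h := by
  obtain ⟨K₀, P₀, f₀, g₀, h₀, hP⟩ := M.exists_presentation
  exact h₀.exists_extend_of_presentation (hM _ _ _ _ h₀ hP) hs

theorem GrExtVanish.of_projective {M : GrMod 𝒜} (hM : Module.Projective A M.carrier)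
    (N : GrMod 𝒜) (i : ℕ) : GrExtVanish i M N := by
  have key : ∀ (M : GrMod 𝒜), Module.Projective A M.carrier → ∀ (K P : GrMod 𝒜)
      (f : K.carrier →ₗ[A] P.carrier) (g : P.carrier →ₗ[A] M.carrier), IsGrSES f g →
      ∃ r ∈ grHom P K, r ∘ₗ f = LinearMap.id := by
    intro M hM K P f g hs
    obtain ⟨σ, hσ, hσg⟩ := grHom_exists_lift hs.right_mem hs.surj (grHom_id M)
    -- With a section `σ` of `g`, the map `1 - σ g` takes values in the kernel and is the required
    -- retraction.
    obtain ⟨r, hr, hrf⟩ := hs.exists_factor (sub_mem (grHom_id P) (grHom_comp hσ hs.right_mem)) (by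
      rw [LinearMap.comp_sub, ← LinearMap.comp_assoc, hσg, LinearMap.comp_id, LinearMap.id_comp,
        sub_self])
    refine ⟨r, hr, LinearMap.ext fun x => hs.inj ?_⟩
    have := LinearMap.congr_fun hrf (f x)
    simpa [hs.exact.apply_apply_eq_zero] using this
  induction i generalizing M with
  | zero =>
    intro K P f g hs _ h hh
    obtain ⟨r, hr, hrf⟩ := key M hM K P f g hs
    exact ⟨h ∘ₗ r, grHom_comp hh hr, by rw [LinearMap.comp_assoc, hrf, LinearMap.comp_id]⟩
  | succ i ih =>
    intro K P f g hs hP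
    obtain ⟨r, hr, hrf⟩ := key M hM K P f g hs
    exact ih (Module.Projective.of_split f r hrf)

/-- The kernel of a composition of surjections is an extension of the kernels. -/
theorem IsGrSES.exists_comp_kernel {M₁ M₂ M₃ K P : GrMod 𝒜} {f : M₁.carrier →ₗ[A] M₂.carrier}
    {g : M₂.carrier →ₗ[A] M₃.carrier} (h : IsGrSES f g) {a : K.carrier →ₗ[A] P.carrier}
    {p : P.carrier →ₗ[A] M₂.carrier} (hp : IsGrSES a p) :
    ∃ (E : GrMod 𝒜) (i : E.carrier →ₗ[A] P.carrier) (j : K.carrier →ₗ[A] E.carrier)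
      (q : E.carrier →ₗ[A] M₁.carrier), IsGrSES i (g ∘ₗ p) ∧ IsGrSES j q ∧ i ∘ₗ j = a ∧
        f ∘ₗ q = p ∘ₗ i := by
  obtain ⟨E, i, hE⟩ :=
    exists_isGrSES (grHom_comp h.right_mem hp.right_mem) (h.surj.comp hp.surj)
  obtain ⟨j, hj, hji⟩ := hE.exists_factor hp.left_mem (by
    rw [LinearMap.comp_assoc, hp.exact.linearMap_comp_eq_zero, LinearMap.comp_zero])
  obtain ⟨q, hq, hqf⟩ := h.exists_factor (grHom_comp hp.right_mem hE.left_mem)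
    hE.exact.linearMap_comp_eq_zero
  have hfq : ∀ x, f (q x) = p (i x) := LinearMap.congr_fun hqf
  have hij : ∀ x, i (j x) = a x := LinearMap.congr_fun hji
  refine ⟨_, i, j, q, hE, ⟨⟨?_, ?_, ?_⟩, hj, hq⟩, hji, hqf⟩
  · exact fun x y hxy => hp.inj (by rw [← hij, ← hij, hxy])
  · intro x
    obtain ⟨y, hy⟩ := hp.surj (f x)
    obtain ⟨z, rfl⟩ := (hE.exact y).1 (by
      rw [LinearMap.comp_apply, hy, h.exact.apply_apply_eq_zero])
    exact ⟨z, h.inj ((hfq z).trans hy)⟩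
  · intro x
    constructor
    · intro hx
      obtain ⟨y, hy⟩ := (hp.exact (i x)).1 (by rw [← hfq, hx, map_zero])
      exact ⟨y, hE.inj ((hij y).trans hy)⟩
    · rintro ⟨y, rfl⟩
      apply h.inj
      rw [map_zero, hfq, hij, hp.exact.apply_apply_eq_zero]

/-- The horseshoe lemma. -/
theorem IsGrSES.exists_horseshoe {M₁ M₂ M₃ K₁ P₁ K₃ P₃ : GrMod 𝒜}
    {f : M₁.carrier →ₗ[A] M₂.carrier} {g : M₂.carrier →ₗ[A] M₃.carrier} (h : IsGrSES f g)
    {a₁ : K₁.carrier →ₗ[A] P₁.carrier} {p₁ : P₁.carrier →ₗ[A] M₁.carrier} (h₁ : IsGrSES a₁ p₁)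
    {a₃ : K₃.carrier →ₗ[A] P₃.carrier} {p₃ : P₃.carrier →ₗ[A] M₃.carrier} (h₃ : IsGrSES a₃ p₃)
    (hP₁ : Module.Projective A P₁.carrier) (hP₃ : Module.Projective A P₃.carrier) :
    ∃ (K P : GrMod 𝒜) (a : K.carrier →ₗ[A] P.carrier) (p : P.carrier →ₗ[A] M₂.carrier)
      (α : K₁.carrier →ₗ[A] K.carrier) (β : K.carrier →ₗ[A] K₃.carrier)
      (i : P₁.carrier →ₗ[A] P.carrier) (r : P.carrier →ₗ[A] P₁.carrier),
      IsGrSES a p ∧ Module.Projective A P.carrier ∧ IsGrSES α β ∧ i ∈ grHom P₁ P ∧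
        r ∈ grHom P P₁ ∧ a ∘ₗ α = i ∘ₗ a₁ ∧ r ∘ₗ i = LinearMap.id := by
  obtain ⟨l, hl, hlg⟩ := grHom_exists_lift h.right_mem h.surj h₃.right_mem
  have hgl : ∀ x, g (l x) = p₃ x := LinearMap.congr_fun hlg
  obtain ⟨P, i, j, r, t, ⟨hi, hj, hr, ht⟩, ⟨hri, htj, hti, hrj, hrt⟩, hP⟩ := P₁.exists_prod P₃
  -- On `P₁ ⊕ P₃`, use `f p₁` on the first summand and the lift `l` of `p₃` on the second.
  let p : P.carrier →ₗ[A] M₂.carrier := (f ∘ₗ p₁) ∘ₗ r + l ∘ₗ t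
  have hp : p ∈ grHom P M₂ :=
    add_mem (grHom_comp (grHom_comp h.left_mem h₁.right_mem) hr) (grHom_comp hl ht)
  have happ : ∀ z, p z = f (p₁ (r z)) + l (t z) := fun _ => rfl
  have hps : Function.Surjective p := by
    intro x
    obtain ⟨y, hy⟩ := h₃.surj (g x)
    obtain ⟨z, hz⟩ := (h.exact (x - l y)).1 (by
      rw [map_sub, hgl, hy, sub_self])
    obtain ⟨w, rfl⟩ := h₁.surj z
    exact ⟨i w + j y, by simp [happ, hri, hrj, hti, htj, hz]⟩
  obtain ⟨K, a, hK⟩ := exists_isGrSES hp hps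
  obtain ⟨α, hα, hαa⟩ := hK.exists_factor (grHom_comp hi h₁.left_mem) (by
    refine LinearMap.ext fun x => ?_
    simp [happ, hri, hti, h₁.exact.apply_apply_eq_zero])
  have hpa : ∀ z, f (p₁ (r (a z))) + l (t (a z)) = 0 := hK.exact.apply_apply_eq_zero
  obtain ⟨β, hβ, hβa⟩ := h₃.exists_factor (grHom_comp ht hK.left_mem) (by
    refine LinearMap.ext fun z => ?_
    change p₃ (t (a z)) = 0
    rw [← hgl]
    have := congrArg g (hpa z)
    rwa [map_add, h.exact.apply_apply_eq_zero, zero_add, map_zero] at this)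
  have hα' : ∀ x, a (α x) = i (a₁ x) := LinearMap.congr_fun hαa
  have hβ' : ∀ x, a₃ (β x) = t (a x) := LinearMap.congr_fun hβa
  refine ⟨K, P, a, p, α, β, i, r, hK, hP hP₁ hP₃, ⟨⟨?_, ?_, ?_⟩, hα, hβ⟩, hi, hr, hαa,
    LinearMap.ext hri⟩
  · exact fun x y hxy => h₁.inj (by rw [← hri (a₁ x), ← hri (a₁ y), ← hα', ← hα', hxy])
  · intro y
    obtain ⟨z, hz⟩ := (h.exact (l (a₃ y))).1 (by
      rw [hgl, h₃.exact.apply_apply_eq_zero])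
    obtain ⟨x, rfl⟩ := h₁.surj z
    obtain ⟨w, hw⟩ := (hK.exact (j (a₃ y) - i x)).1 (by
      simp [happ, hri, hrj, hti, htj, hz])
    exact ⟨w, h₃.inj (by rw [hβ', hw]; simp [htj, hti])⟩
  · intro x
    constructor
    · intro hx
      have hz : t (a x) = 0 := by rw [← hβ', hx, map_zero]
      have hyz := hpa x
      rw [hz, map_zero, add_zero, ← map_zero f] at hyz
      obtain ⟨w, hw⟩ := (h₁.exact _).1 (h.inj hyz)
      refine ⟨w, hK.inj ?_⟩
      have := hrt (a x)
      rw [hz, map_zero, add_zero] at this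
      rw [hα', hw, this]
    · rintro ⟨y, rfl⟩
      apply h₃.inj
      rw [map_zero, hβ', hα', hti]

/-- Exactness of `ext^{n+1}(M₂,N) → ext^{n+1}(M₁,N) → ext^{n+2}(M₃,N)`. In the base case a map on
`K₁` extends to the horseshoe kernel `K`, then to `P`, and is restricted to `P₁`. -/
theorem IsGrSES.grExtVanish_left {M₁ M₂ M₃ N : GrMod 𝒜} {f : M₁.carrier →ₗ[A] M₂.carrier}
    {g : M₂.carrier →ₗ[A] M₃.carrier} (h : IsGrSES f g) {n : ℕ} (h₂ : GrExtVanish n M₂ N)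
    (h₃ : GrExtVanish (n + 1) M₃ N) : GrExtVanish n M₁ N := by
  induction n generalizing M₁ M₂ M₃ with
  | zero =>
    intro K₁ P₁ a₁ p₁ hs₁ hP₁ b hb
    obtain ⟨K₃, P₃, a₃, p₃, hs₃, hP₃⟩ := M₃.exists_presentation
    obtain ⟨K, P, a, p, α, β, i, r, hs, hP, hK, hi, hr, hαi, hri⟩ :=
      h.exists_horseshoe hs₁ hs₃ hP₁ hP₃
    have hK₃ : GrExtVanish 0 K₃ N := h₃ _ _ _ _ hs₃ hP₃
    obtain ⟨c, hc, hcα⟩ := hK₃.exists_extend hK b hb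
    obtain ⟨d, hd, hda⟩ := h₂.exists_extend hs c hc
    exact ⟨d ∘ₗ i, grHom_comp hd hi, by
      rw [LinearMap.comp_assoc, ← hαi, ← LinearMap.comp_assoc, hda, hcα]⟩
  | succ n ih =>
    intro K₁ P₁ a₁ p₁ hs₁ hP₁
    obtain ⟨K₃, P₃, a₃, p₃, hs₃, hP₃⟩ := M₃.exists_presentation
    obtain ⟨K, P, a, p, α, β, i, r, hs, hP, hK, -⟩ := h.exists_horseshoe hs₁ hs₃ hP₁ hP₃
    exact ih hK (h₂ _ _ _ _ hs hP) (h₃ _ _ _ _ hs₃ hP₃)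

/-- Exactness of `hom(M₂,N) → hom(M₁,N) → ext^1(M₃,N) → ext^1(M₂,N)`. For `b` on `E = ker(P → M₃)`,
correct `b` by a map `w` on `P` so that it factors through `M₁`, and extend the result to `M₂`. -/
theorem IsGrSES.grExtVanish_zero_of_extend {M₁ M₂ M₃ N : GrMod 𝒜}
    {f : M₁.carrier →ₗ[A] M₂.carrier} {g : M₂.carrier →ₗ[A] M₃.carrier} (h : IsGrSES f g)
    (h₁ : ∀ b ∈ grHom M₁ N, ∃ c ∈ grHom M₂ N, c ∘ₗ f = b) (h₂ : GrExtVanish 0 M₂ N) :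
    GrExtVanish 0 M₃ N := by
  obtain ⟨K, P, a, p, hs, hP⟩ := M₂.exists_presentation
  obtain ⟨E, i, j, q, hE, hK, hij, hfq⟩ := h.exists_comp_kernel hs
  intro K' P' a' p' hs' hP'
  refine hE.exists_extend_of_presentation (fun b hb => ?_) hs'
  obtain ⟨w, hw, hwa⟩ := h₂.exists_extend hs (b ∘ₗ j) (grHom_comp hb hK.left_mem)
  obtain ⟨v, hv, hvq⟩ := hK.exists_factor' (sub_mem hb (grHom_comp hw hE.left_mem)) (by
    rw [LinearMap.sub_comp, LinearMap.comp_assoc, hij, hwa, sub_self])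
  obtain ⟨c, hc, hcf⟩ := h₁ v hv
  refine ⟨w + c ∘ₗ p, add_mem hw (grHom_comp hc hs.right_mem), ?_⟩
  rw [LinearMap.add_comp, LinearMap.comp_assoc, ← hfq, ← LinearMap.comp_assoc, hcf, hvq]
  abel

/-- Exactness of `ext^{n+1}(M₁,N) → ext^{n+2}(M₃,N) → ext^{n+2}(M₂,N)`. The base case needs the
retraction `r : P → P₁` of the horseshoe to extend maps from `K₁` to `K`. -/
theorem IsGrSES.grExtVanish_right {M₁ M₂ M₃ N : GrMod 𝒜} {f : M₁.carrier →ₗ[A] M₂.carrier}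
    {g : M₂.carrier →ₗ[A] M₃.carrier} (h : IsGrSES f g) {n : ℕ} (h₁ : GrExtVanish n M₁ N)
    (h₂ : GrExtVanish (n + 1) M₂ N) : GrExtVanish (n + 1) M₃ N := by
  induction n generalizing M₁ M₂ M₃ with
  | zero =>
    intro K₃ P₃ a₃ p₃ hs₃ hP₃
    obtain ⟨K₁, P₁, a₁, p₁, hs₁, hP₁⟩ := M₁.exists_presentation
    obtain ⟨K, P, a, p, α, β, i, r, hs, hP, hK, hi, hr, hαi, hri⟩ :=
      h.exists_horseshoe hs₁ hs₃ hP₁ hP₃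
    refine hK.grExtVanish_zero_of_extend (fun b hb => ?_) (h₂ _ _ _ _ hs hP)
    obtain ⟨c, hc, hca⟩ := h₁ _ _ _ _ hs₁ hP₁ b hb
    refine ⟨c ∘ₗ r ∘ₗ a, grHom_comp hc (grHom_comp hr hs.left_mem), ?_⟩
    rw [LinearMap.comp_assoc, LinearMap.comp_assoc, hαi, ← LinearMap.comp_assoc a₁ i r, hri,
      LinearMap.id_comp, hca]
  | succ n ih =>
    intro K₃ P₃ a₃ p₃ hs₃ hP₃
    obtain ⟨K₁, P₁, a₁, p₁, hs₁, hP₁⟩ := M₁.exists_presentation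
    obtain ⟨K, P, a, p, α, β, i, r, hs, hP, hK, -⟩ := h.exists_horseshoe hs₁ hs₃ hP₁ hP₃
    exact ih hK (h₁ _ _ _ _ hs₁ hP₁) (h₂ _ _ _ _ hs hP)

theorem IsGrSES.grExtVanish_mid {M₁ M₂ M₃ N : GrMod 𝒜} {f : M₁.carrier →ₗ[A] M₂.carrier}
    {g : M₂.carrier →ₗ[A] M₃.carrier} (h : IsGrSES f g) {n : ℕ} (h₁ : GrExtVanish n M₁ N)
    (h₃ : GrExtVanish n M₃ N) : GrExtVanish n M₂ N := by
  induction n generalizing M₁ M₂ M₃ with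
  | zero =>
    intro K P a p hs hP b hb
    obtain ⟨E, i, j, q, hE, hK, hij, hfq⟩ := h.exists_comp_kernel hs
    obtain ⟨c, hc, hcj⟩ := h₁.exists_extend hK b hb
    obtain ⟨d, hd, hdi⟩ := h₃.exists_extend hE c hc
    exact ⟨d, hd, by rw [← hij, ← LinearMap.comp_assoc, hdi, hcj]⟩
  | succ n ih =>
    obtain ⟨K₁, P₁, a₁, p₁, hs₁, hP₁⟩ := M₁.exists_presentation
    obtain ⟨K₃, P₃, a₃, p₃, hs₃, hP₃⟩ := M₃.exists_presentation
    obtain ⟨K, P, a, p, α, β, i, r, hs, hP, hK, -⟩ := h.exists_horseshoe hs₁ hs₃ hP₁ hP₃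
    -- The induction hypothesis treats the horseshoe kernel only; the right-term lemma passes from
    -- this presentation of `M₂` to all of them.
    exact hs.grExtVanish_right (ih hK (h₁ _ _ _ _ hs₁ hP₁) (h₃ _ _ _ _ hs₃ hP₃))
      (GrExtVanish.of_projective hP N _)

/-- A presentation of the shifted module is shifted back to one of `M`; the conditions on `κ` and
`π` record the shift. -/
theorem IsGrSES.exists_unshift {K P M M' : GrMod 𝒜} {a : K.carrier →ₗ[A] P.carrier}
    {p : P.carrier →ₗ[A] M'.carrier} (hs : IsGrSES a p) {r : ℤ}
    (φ : M.carrier ≃ₗ[A] M'.carrier) (hφ : ∀ j x, x ∈ M.deg j ↔ φ x ∈ M'.deg (j + r)) :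
    ∃ (K' P' : GrMod 𝒜) (a' : K'.carrier →ₗ[A] P'.carrier) (p' : P'.carrier →ₗ[A] M.carrier)
      (κ : K'.carrier ≃ₗ[A] K.carrier) (_ : ∀ j x, x ∈ K'.deg j ↔ κ x ∈ K.deg (j + r))
      (π : P'.carrier ≃ₗ[A] P.carrier) (_ : ∀ j x, x ∈ P'.deg j ↔ π x ∈ P.deg (j + r)),
      (∀ x, π (a' x) = a (κ x)) ∧ IsGrSES a' p' := by
  obtain ⟨K', κ, hκ⟩ := K.exists_shift (-r)
  obtain ⟨P', π, hπ⟩ := P.exists_shift (-r)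
  have hκ' : ∀ j x, x ∈ K'.deg j ↔ κ.symm x ∈ K.deg (j + r) := fun j x => by
    rw [hκ, κ.apply_symm_apply, add_neg_cancel_right]
  have hπ' : ∀ j x, x ∈ P'.deg j ↔ π.symm x ∈ P.deg (j + r) := fun j x => by
    rw [hπ, π.apply_symm_apply, add_neg_cancel_right]
  refine ⟨K', P', π.toLinearMap ∘ₗ a ∘ₗ κ.symm.toLinearMap,
    φ.symm.toLinearMap ∘ₗ p ∘ₗ π.symm.toLinearMap, κ.symm, hκ', π.symm, hπ',
    fun x => by simp, ⟨?_, ?_, ?_⟩, fun j x hx => ?_, fun j x hx => ?_⟩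
  · exact π.injective.comp (hs.inj.comp κ.symm.injective)
  · exact φ.symm.surjective.comp (hs.surj.comp π.symm.surjective)
  · intro x
    simp only [LinearMap.comp_apply, LinearEquiv.coe_coe, LinearEquiv.map_eq_zero_iff]
    rw [hs.exact]
    constructor
    · rintro ⟨y, hy⟩
      exact ⟨κ y, by simp [hy]⟩
    · rintro ⟨y, rfl⟩
      exact ⟨κ.symm y, by simp⟩
  · rw [hπ']
    simpa using hs.left_mem _ _ ((hκ' j x).1 hx)
  · rw [hφ]
    simpa using hs.right_mem _ _ ((hπ' j x).1 hx)

/-- Invariance of the vanishing of `ext^{i+1}(M, N)` under isomorphisms and a simultaneous shift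
of `M` and `N`. -/
theorem GrExtVanish.congr_shift {M N M' N' : GrMod 𝒜} (r : ℤ) (φ : M.carrier ≃ₗ[A] M'.carrier)
    (hφ : ∀ j x, x ∈ M.deg j ↔ φ x ∈ M'.deg (j + r)) (ψ : N.carrier ≃ₗ[A] N'.carrier)
    (hψ : ∀ j x, x ∈ N.deg j ↔ ψ x ∈ N'.deg (j + r)) {n : ℕ} (h : GrExtVanish n M N) :
    GrExtVanish n M' N' := by
  induction n generalizing M M' with
  | zero =>
    intro K P a p hs hP b hb
    obtain ⟨K', P', a', p', κ, hκ, π, hπ, ha', hs'⟩ := hs.exists_unshift φ hφ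
    obtain ⟨c, hc, hca⟩ := h _ _ _ _ hs' (Module.Projective.of_equiv π.symm)
      (ψ.symm.toLinearMap ∘ₗ b ∘ₗ κ.toLinearMap) (by
        intro j x hx
        simp only [hψ, LinearMap.comp_apply, LinearEquiv.coe_coe, ψ.apply_symm_apply]
        exact hb _ _ ((hκ j x).1 hx))
    refine ⟨ψ.toLinearMap ∘ₗ c ∘ₗ π.symm.toLinearMap, fun j x hx => ?_, ?_⟩
    · have h1 : π.symm x ∈ P'.deg (j - r) := by
        rwa [hπ, π.apply_symm_apply, sub_add_cancel]
      have := (hψ _ _).1 (hc _ _ h1)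
      rwa [sub_add_cancel] at this
    · refine LinearMap.ext fun x => ?_
      have := LinearMap.congr_fun hca (κ.symm x)
      simp only [LinearMap.comp_apply, LinearEquiv.coe_coe, κ.apply_symm_apply] at this ⊢
      have hx : π.symm (a x) = a' (κ.symm x) := by
        rw [LinearEquiv.symm_apply_eq, ha', κ.apply_symm_apply]
      rw [hx, this, ψ.apply_symm_apply]
  | succ n ih =>
    intro K P a p hs hP
    obtain ⟨K', P', a', p', κ, hκ, π, hπ, ha', hs'⟩ := hs.exists_unshift φ hφ
    exact ih κ hκ (h _ _ _ _ hs' (Module.Projective.of_equiv π.symm))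

end GradedExt

section Comparison

variable {k A : Type u} [Field k] [Ring A] [Algebra k A] {𝒜 : ℕ → Submodule k A}
  [GradedAlgebra 𝒜]

/-! ### Comparison with resolutions and with ungraded Ext groups -/

/-- A graded projective resolution of `K` and a projective presentation of `M` with kernel `K`
define a graded projective resolution of `M`. -/
def GrProjRes.cons {K P M : GrMod 𝒜} {a : K.carrier →ₗ[A] P.carrier}
    {p : P.carrier →ₗ[A] M.carrier} (hs : IsGrSES a p) (hP : Module.Projective A P.carrier)
    (R : GrProjRes K) : GrProjRes M where
  P n := Nat.casesOn n P R.P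
  projective n := by
    cases n with
    | zero => exact hP
    | succ n => exact R.projective n
  aug := p
  aug_mem := hs.right_mem
  d n := match n with
    | 0 => a ∘ₗ R.aug
    | n + 1 => R.d n
  d_mem n := by
    cases n with
    | zero => exact grHom_comp hs.left_mem R.aug_mem
    | succ n => exact R.d_mem n
  aug_surjective := hs.surj
  exact_zero x := by
    refine (hs.exact x).trans ⟨?_, ?_⟩
    · rintro ⟨y, rfl⟩
      obtain ⟨z, rfl⟩ := R.aug_surjective y
      exact ⟨z, rfl⟩
    · rintro ⟨z, rfl⟩
      exact ⟨R.aug z, rfl⟩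
  exact_succ n := by
    cases n with
    | zero =>
      intro x
      refine Iff.trans ?_ (R.exact_zero x)
      exact ⟨fun h => hs.inj (h.trans (map_zero a).symm), fun h =>
        (congrArg a h).trans (map_zero a)⟩
    | succ n => exact R.exact_succ n

/-- The kernel of the canonical free cover of a graded module. -/
noncomputable def GrMod.syz (M : GrMod 𝒜) : GrMod 𝒜 := M.exists_presentation.choose

theorem GrMod.exists_syz (M : GrMod 𝒜) :
    ∃ (P : GrMod 𝒜) (f : M.syz.carrier →ₗ[A] P.carrier) (g : P.carrier →ₗ[A] M.carrier),
      IsGrSES f g ∧ Module.Projective A P.carrier := M.exists_presentation.choose_spec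

/-- The iterated syzygies of a graded module. -/
noncomputable def GrMod.iterSyz (M : GrMod 𝒜) : ℕ → GrMod 𝒜
  | 0 => M
  | n + 1 => (M.iterSyz n).syz

/-- Since the syzygies are fixed beforehand, presentations chosen independently for each `n` splice.
-/
theorem GrMod.exists_grProjRes (M : GrMod 𝒜) : Nonempty (GrProjRes M) := by
  have hS : ∀ n, ∃ (P : GrMod 𝒜) (f : (M.iterSyz (n + 1)).carrier →ₗ[A] P.carrier)
      (g : P.carrier →ₗ[A] (M.iterSyz n).carrier), IsGrSES f g ∧ Module.Projective A P.carrier :=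
    fun n => (M.iterSyz n).exists_syz
  choose P f g hs hP using hS
  exact ⟨{
    P := P
    projective := hP
    aug := g 0
    aug_mem := (hs 0).right_mem
    d := fun n => f n ∘ₗ g (n + 1)
    d_mem := fun n => grHom_comp (hs n).left_mem (hs (n + 1)).right_mem
    aug_surjective := (hs 0).surj
    exact_zero := fun x => ((hs 0).exact x).trans ⟨by
      rintro ⟨y, rfl⟩
      obtain ⟨z, rfl⟩ := (hs 1).surj y
      exact ⟨z, rfl⟩, by rintro ⟨z, rfl⟩; exact ⟨_, rfl⟩⟩
    exact_succ := fun n x => by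
      have h1 : (f n ∘ₗ g (n + 1)) x = 0 ↔ g (n + 1) x = 0 :=
        ⟨fun h => (hs n).inj (h.trans (map_zero _).symm), fun h =>
          (congrArg (f n) h).trans (map_zero _)⟩
      refine h1.trans (((hs (n + 1)).exact x).trans ⟨?_, ?_⟩)
      · rintro ⟨y, rfl⟩
        obtain ⟨z, rfl⟩ := (hs (n + 2)).surj y
        exact ⟨z, rfl⟩
      · rintro ⟨z, rfl⟩
        exact ⟨_, rfl⟩ }⟩

/-- Every presentation is the start of a resolution, by `GrProjRes.cons`. A map `h` on `K` gives the
1-cocycle `h ∘ aug`, and a primitive of it extends `h` because `aug` is onto. In higher degrees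
`cons` shifts cocycles and coboundaries by one, definitionally. -/
theorem GrExtVanish.of_grProjRes {M N : GrMod 𝒜} {n : ℕ}
    (H : ∀ R : GrProjRes M, R.cocycles N (n + 1) ≤ R.coboundaries N (n + 1)) :
    GrExtVanish n M N := by
  induction n generalizing M with
  | zero =>
    intro K P a p hs hP h hh
    obtain ⟨R⟩ := K.exists_grProjRes
    have hc : h ∘ₗ R.aug ∈ (R.cons hs hP).cocycles N 1 := by
      refine ⟨grHom_comp hh R.aug_mem, ?_⟩
      refine LinearMap.ext fun x => ?_
      exact (congrArg h (R.exact_zero.apply_apply_eq_zero x)).trans (map_zero h)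
    obtain ⟨b, hb, hbe⟩ := H (R.cons hs hP) hc
    refine ⟨b, hb, LinearMap.ext fun x => ?_⟩
    obtain ⟨y, rfl⟩ := R.aug_surjective x
    exact LinearMap.congr_fun hbe y
  | succ n ih =>
    intro K P a p hs hP
    exact ih fun R => H (R.cons hs hP)

/-- Vanishing of ungraded Ext groups implies the vanishing of graded ones. -/
theorem GrExtVanish.of_extZero {M N : GrMod 𝒜} {n : ℕ}
    (h : ExtZero A M.carrier N.carrier (n + 1)) : GrExtVanish n M N := by
  induction n generalizing M with
  | zero =>
    intro K P a p hs hP b hb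
    exact grHom_exists_extend hs.left_mem hb (hs.exists_extend h b)
  | succ n ih =>
    intro K P a p hs hP
    exact ih (hs.extZero_left (extZero_of_projective _ _ _) h)

end Comparison

section Inflation

variable {k A : Type u} [Field k] [Ring A] [Algebra k A] {𝒜 : ℕ → Submodule k A}
  [GradedAlgebra 𝒜]

/-! ### Modules concentrated in one grade -/

theorem projZero_coe (a : GrZero 𝒜) : projZero 𝒜 (a : A) = a :=
  Subtype.ext (DirectSum.decompose_of_mem_same 𝒜 a.2)

theorem projZero_of_mem {i : ℕ} (hi : i ≠ 0) {a : A} (ha : a ∈ 𝒜 i) : projZero 𝒜 a = 0 :=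
  Subtype.ext (DirectSum.decompose_of_mem_ne 𝒜 ha hi)

variable {X Y Z : Type u} [AddCommGroup X] [Module (GrZero 𝒜) X] [AddCommGroup Y]
  [Module (GrZero 𝒜) Y] [AddCommGroup Z] [Module (GrZero 𝒜) Z]

/-- The graded `A`-module `X`, concentrated in grade `s`. -/
def inflateAt (𝒜 : ℕ → Submodule k A) [GradedAlgebra 𝒜] (X : Type u) [AddCommGroup X]
    [Module (GrZero 𝒜) X] (s : ℤ) : GrMod 𝒜 := (inflate 𝒜 X).shift s

/-- The identity map from `X` to its inflation. -/
def inflateEquiv (X : Type u) [AddCommGroup X] [Module (GrZero 𝒜) X] (s : ℤ) :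
    X ≃+ (inflateAt 𝒜 X s).carrier := AddEquiv.refl X

theorem smul_inflateEquiv (s : ℤ) (a : A) (x : X) :
    a • inflateEquiv (𝒜 := 𝒜) X s x = inflateEquiv X s (projZero 𝒜 a • x) := rfl

theorem mem_inflateAt_self (s : ℤ) (x : (inflateAt 𝒜 X s).carrier) :
    x ∈ (inflateAt 𝒜 X s).deg s := by
  have : (inflateAt 𝒜 X s).deg s = ⊤ := if_pos (sub_self s)
  rw [this]
  trivial

theorem eq_zero_of_mem_inflateAt {s j : ℤ} (hj : j ≠ s) {x : (inflateAt 𝒜 X s).carrier}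
    (hx : x ∈ (inflateAt 𝒜 X s).deg j) : x = 0 := by
  have : (inflateAt 𝒜 X s).deg j = ⊥ := if_neg (sub_ne_zero.2 hj)
  rwa [this] at hx

/-- The inflation of a homomorphism. -/
def inflateMap (f : X →ₗ[GrZero 𝒜] Y) (s : ℤ) :
    (inflateAt 𝒜 X s).carrier →ₗ[A] (inflateAt 𝒜 Y s).carrier where
  toFun x := inflateEquiv Y s (f ((inflateEquiv X s).symm x))
  map_add' x y := by simp only [map_add]
  map_smul' a x := by
    obtain ⟨x, rfl⟩ := (inflateEquiv X s).surjective x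
    rw [smul_inflateEquiv, AddEquiv.symm_apply_apply, AddEquiv.symm_apply_apply, map_smul,
      RingHom.id_apply, smul_inflateEquiv]

theorem inflateMap_mem (f : X →ₗ[GrZero 𝒜] Y) (s : ℤ) :
    inflateMap f s ∈ grHom (inflateAt 𝒜 X s) (inflateAt 𝒜 Y s) := by
  intro j x hx
  by_cases hj : j = s
  · subst hj
    exact mem_inflateAt_self _ _
  · rw [eq_zero_of_mem_inflateAt hj hx, map_zero]
    exact zero_mem _

theorem IsSES.inflate {f : X →ₗ[GrZero 𝒜] Y} {g : Y →ₗ[GrZero 𝒜] Z} (h : IsSES f g) (s : ℤ) :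
    IsGrSES (inflateMap f s) (inflateMap g s) :=
  ⟨⟨h.inj, h.surj, h.exact⟩, inflateMap_mem f s, inflateMap_mem g s⟩

/-- The grade `s` part of a graded module, as an `A_0`-module. -/
def GrMod.grade (M : GrMod 𝒜) (s : ℤ) : Submodule (GrZero 𝒜) M.carrier where
  carrier := M.deg s
  zero_mem' := zero_mem _
  add_mem' := add_mem
  smul_mem' a x hx := by
    have := M.smul_mem 0 s (a : A) x a.2 hx
    rwa [Nat.cast_zero, zero_add] at this

/-- The grade `s` part of a graded homomorphism. -/
def gradeMap {M N : GrMod 𝒜} {f : M.carrier →ₗ[A] N.carrier} (hf : f ∈ grHom M N) (s : ℤ) :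
    M.grade s →ₗ[GrZero 𝒜] N.grade s where
  toFun x := ⟨f x, hf s x.1 x.2⟩
  map_add' x y := Subtype.ext (map_add f x.1 y.1)
  map_smul' a x := Subtype.ext (map_smul f (a : A) x.1)

theorem IsGrSES.grade {K E M : GrMod 𝒜} {f : K.carrier →ₗ[A] E.carrier}
    {g : E.carrier →ₗ[A] M.carrier} (h : IsGrSES f g) (s : ℤ) :
    IsSES (gradeMap h.left_mem s) (gradeMap h.right_mem s) := by
  refine ⟨fun x y hxy => Subtype.ext (h.inj (congrArg Subtype.val hxy)), ?_, ?_⟩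
  · rintro ⟨y, hy⟩
    obtain ⟨x, hx, rfl⟩ := grHom_exists_of_mem h.right_mem h.surj hy
    exact ⟨⟨x, hx⟩, rfl⟩
  · rintro ⟨x, hx⟩
    constructor
    · intro h0
      obtain ⟨y, rfl⟩ := (h.exact x).1 (congrArg Subtype.val h0)
      exact ⟨⟨y, h.mem_of_left hx⟩, rfl⟩
    · rintro ⟨y, hy⟩
      rw [← hy]
      exact Subtype.ext (h.exact.apply_apply_eq_zero y.1)

/-- The homomorphism to a module concentrated in grade `s` that is defined by a homomorphism on
the grade `s` part, which has to be the lowest one. -/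
noncomputable def toInflate {M : GrMod 𝒜} {s : ℤ} (hM : ∀ j < s, M.deg j = ⊥)
    (f : M.grade s →ₗ[GrZero 𝒜] X) : M.carrier →ₗ[A] (inflateAt 𝒜 X s).carrier :=
  linearOfHomogeneous 𝒜
    ((inflateEquiv X s).toAddMonoidHom.comp (f.toAddMonoidHom.comp
      ((M.proj s).codRestrict (M.grade s) (M.proj_mem s)))) fun i a ha x => by
    change inflateEquiv X s (f ⟨M.proj s (a • x), _⟩) = a • inflateEquiv X s (f ⟨M.proj s x, _⟩)
    rw [smul_inflateEquiv]
    congr 1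
    by_cases hi : i = 0
    · subst hi
      have h0 : projZero 𝒜 a = ⟨a, ha⟩ := projZero_coe (𝒜 := 𝒜) ⟨a, ha⟩
      rw [h0, ← map_smul]
      congr 1
      apply Subtype.ext
      change M.proj s (a • x) = a • M.proj s x
      rw [M.proj_smul ha, Nat.cast_zero, sub_zero]
    · rw [projZero_of_mem hi ha, zero_smul]
      have h0 : M.proj s (a • x) = 0 := by
        have := M.proj_mem (s - i) x
        rw [hM _ (by omega), AddSubgroup.mem_bot] at this
        rw [M.proj_smul ha, this, smul_zero]
      have : (⟨M.proj s (a • x), M.proj_mem s _⟩ : M.grade s) = 0 := Subtype.ext h0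
      rw [this, map_zero]

theorem toInflate_of_mem {M : GrMod 𝒜} {s : ℤ} (hM : ∀ j < s, M.deg j = ⊥)
    (f : M.grade s →ₗ[GrZero 𝒜] X) (x : M.grade s) :
    toInflate hM f x = inflateEquiv X s (f x) := by
  change inflateEquiv X s (f ⟨M.proj s x, _⟩) = _
  congr 2
  exact Subtype.ext (M.proj_of_mem x.2)

theorem toInflate_mem {M : GrMod 𝒜} {s : ℤ} (hM : ∀ j < s, M.deg j = ⊥)
    (f : M.grade s →ₗ[GrZero 𝒜] X) : toInflate hM f ∈ grHom M (inflateAt 𝒜 X s) := by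
  intro j x hx
  by_cases hj : j = s
  · subst hj
    exact mem_inflateAt_self _ _
  · have : toInflate hM f x = 0 := by
      change inflateEquiv X s (f ⟨M.proj s x, _⟩) = 0
      have : (⟨M.proj s x, M.proj_mem s _⟩ : M.grade s) = 0 :=
        Subtype.ext (M.proj_of_mem_ne hj hx)
      rw [this, map_zero, map_zero]
    rw [this]
    exact zero_mem _

/-- The restriction to the grade `s` part of a homomorphism to a module concentrated in
grade `s`. -/
def ofInflate {M : GrMod 𝒜} {s : ℤ} (f : M.carrier →ₗ[A] (inflateAt 𝒜 X s).carrier) :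
    M.grade s →ₗ[GrZero 𝒜] X where
  toFun x := (inflateEquiv X s).symm (f x)
  map_add' x y := by
    rw [Submodule.coe_add, map_add, map_add]
  map_smul' a x := by
    have h1 : f ((a • x : M.grade s) : M.carrier) = (a : A) • f x := map_smul f (a : A) x.1
    obtain ⟨y, hy⟩ := (inflateEquiv X s).surjective (f x)
    rw [h1, ← hy, smul_inflateEquiv, AddEquiv.symm_apply_apply, AddEquiv.symm_apply_apply,
      projZero_coe, RingHom.id_apply]

/-- Cover `P_s` by a free `A_0`-module `F`. As `s` is the lowest grade, `P → P_s⟨s⟩` is a graded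
map; it lifts to `F⟨s⟩`, and grade `s` of the lift splits the cover. -/
theorem grade_projective {P : GrMod 𝒜} {s : ℤ} (hP : ∀ j < s, P.deg j = ⊥)
    [Module.Projective A P.carrier] : Module.Projective (GrZero 𝒜) (P.grade s) := by
  let π : (P.grade s →₀ GrZero 𝒜) →ₗ[GrZero 𝒜] P.grade s :=
    Finsupp.linearCombination (GrZero 𝒜) id
  have hπ : Function.Surjective π := Finsupp.linearCombination_id_surjective _ _
  obtain ⟨h, hh, hπh⟩ := grHom_exists_lift (g := inflateMap π s) (inflateMap_mem π s) hπ
    (toInflate_mem hP LinearMap.id)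
  refine Module.Projective.of_split (ofInflate h) π (LinearMap.ext fun x => ?_)
  have := LinearMap.congr_fun hπh x
  rw [toInflate_of_mem] at this
  exact this

/-- If `M` lives in grades `≥ s`, then `ext^{n+1}_A(M, Y⟨s⟩) = 0` implies
`Ext^{n+1}_{A_0}(M_s, Y) = 0`. -/
theorem GrExtVanish.extZero_grade {M : GrMod 𝒜} {s : ℤ} (hM : ∀ j < s, M.deg j = ⊥) {n : ℕ}
    (h : GrExtVanish n M (inflateAt 𝒜 Y s)) : ExtZero (GrZero 𝒜) (M.grade s) Y (n + 1) := by
  induction n generalizing M with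
  | zero =>
    have hs := M.coverMap_surjective (Set.Ici s) fun j hj => hM j (not_le.1 hj)
    obtain ⟨K, i, hK⟩ := exists_isGrSES (M.coverMap_mem (Set.Ici s)) hs
    have hP : ∀ j < s, (M.cover (Set.Ici s)).deg j = ⊥ :=
      fun j hj => M.cover_deg_eq_bot (fun _ h => h) hj
    have := grade_projective hP
    have hKs : ∀ j < s, K.deg j = ⊥ := by
      intro j hj
      rw [eq_bot_iff]
      intro x hx
      have := hK.left_mem j x hx
      rw [hP j hj, AddSubgroup.mem_bot] at this
      exact hK.inj (this.trans (map_zero _).symm)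
    -- An `A_0`-map on `K_s` is a graded map `K → Y⟨s⟩`; extend it to the cover and restrict to
    -- grade `s`.
    refine (hK.grade s).extZero_one_of_extend fun a => ?_
    obtain ⟨b, hb, hba⟩ := h _ _ _ _ hK inferInstance _ (toInflate_mem hKs a)
    refine ⟨ofInflate b, LinearMap.ext fun x => ?_⟩
    have := LinearMap.congr_fun hba x
    rw [toInflate_of_mem] at this
    exact this
  | succ n ih =>
    have hs := M.coverMap_surjective (Set.Ici s) fun j hj => hM j (not_le.1 hj)
    obtain ⟨K, i, hK⟩ := exists_isGrSES (M.coverMap_mem (Set.Ici s)) hs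
    have hP : ∀ j < s, (M.cover (Set.Ici s)).deg j = ⊥ :=
      fun j hj => M.cover_deg_eq_bot (fun _ h => h) hj
    have := grade_projective hP
    have hKs : ∀ j < s, K.deg j = ⊥ := by
      intro j hj
      rw [eq_bot_iff]
      intro x hx
      have := hK.left_mem j x hx
      rw [hP j hj, AddSubgroup.mem_bot] at this
      exact hK.inj (this.trans (map_zero _).symm)
    exact (hK.grade s).extZero_right (ih hKs (h _ _ _ _ hK inferInstance))
      (extZero_of_projective _ _ _)

/-- The submodule of a graded module in grades `> t`, when the lowest grade is `t`. -/
theorem GrMod.exists_truncation (M : GrMod 𝒜) {t : ℤ} (hM : ∀ j < t, M.deg j = ⊥) :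
    ∃ (K : GrMod 𝒜) (i : K.carrier →ₗ[A] M.carrier)
      (q : M.carrier →ₗ[A] (inflateAt 𝒜 (M.grade t) t).carrier), IsGrSES i q ∧
      (∀ j < t + 1, K.deg j = ⊥) ∧ ∀ j, t < j → Nonempty (K.grade j ≃ₗ[GrZero 𝒜] M.grade j) := by
  have hq := toInflate_mem hM (LinearMap.id (R := GrZero 𝒜) (M := M.grade t))
  obtain ⟨K, i, hK⟩ := exists_isGrSES hq fun y => by
    obtain ⟨x, rfl⟩ := (inflateEquiv (M.grade t) t).surjective y
    exact ⟨x, toInflate_of_mem hM _ x⟩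
  refine ⟨K, i, _, hK, fun j hj => ?_, fun j hj => ⟨?_⟩⟩
  · rw [eq_bot_iff]
    intro x hx
    have hx' := hK.left_mem j x hx
    apply hK.inj
    rw [map_zero]
    rcases (Int.lt_add_one_iff.1 hj).lt_or_eq with hj' | rfl
    · rwa [hM j hj'] at hx'
    · have h1 := toInflate_of_mem hM (LinearMap.id (R := GrZero 𝒜) (M := M.grade j)) ⟨i x, hx'⟩
      rw [hK.exact.apply_apply_eq_zero, LinearMap.id_apply] at h1
      have := (inflateEquiv (M.grade j) j).injective (h1.symm.trans (map_zero _).symm)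
      exact congrArg Subtype.val this
  · refine LinearEquiv.ofBijective (gradeMap hK.left_mem j) ⟨(hK.grade j).inj, ?_⟩
    rintro ⟨y, hy⟩
    obtain ⟨x, rfl⟩ := (hK.exact y).1 (eq_zero_of_mem_inflateAt hj.ne' (hq j y hy))
    exact ⟨⟨x, hK.mem_of_left hy⟩, rfl⟩

end Inflation

section Syzygy

variable {R : Type u} [Ring R]

/-! ### Syzygies -/

/-- Lift a finite free cover of `S` through `g`: the image of the lift together with the superfluous
kernel is all of `P`, so the lift is onto. -/
theorem finite_of_isSuperfluous {P S : Type u} [AddCommGroup P] [Module R P] [AddCommGroup S]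
    [Module R S] [Module.Finite R S] {g : P →ₗ[R] S} (hg : Function.Surjective g)
    (hk : IsSuperfluous (LinearMap.ker g)) : Module.Finite R P := by
  obtain ⟨n, π, hπ⟩ := Module.Finite.exists_fin' R S
  obtain ⟨h, hh⟩ := Module.projective_lifting_property g π hg
  refine Module.Finite.of_surjective h (LinearMap.range_eq_top.1 (hk _ ?_))
  rw [eq_top_iff]
  intro x _
  obtain ⟨y, hy⟩ := hπ (g x)
  have hxy : x - h y ∈ LinearMap.ker g := by
    rw [LinearMap.mem_ker, map_sub, ← LinearMap.comp_apply, hh, hy, sub_self]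
  rw [← sub_add_cancel x (h y)]
  exact add_mem (Submodule.mem_sup_left hxy) (Submodule.mem_sup_right ⟨y, rfl⟩)

theorem MinProjRes.exists_isSES {V : Type u} [AddCommGroup V] [Module R V]
    (Q : MinProjRes (R := R) V) (m : ℕ) :
    ∃ (f : Q.syzygy (m + 1) →ₗ[R] Q.P m) (g : Q.P m →ₗ[R] Q.syzygy m), IsSES f g ∧
      IsSuperfluous (LinearMap.ker g) := by
  have key : ∀ {X Y Z : Type u} [AddCommGroup X] [Module R X] [AddCommGroup Y] [Module R Y]
      [AddCommGroup Z] [Module R Z] (a : X →ₗ[R] Y) (b : Y →ₗ[R] Z), Function.Exact a b →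
      IsSuperfluous (LinearMap.ker a) → ∃ g : X →ₗ[R] LinearMap.ker b,
        IsSES (LinearMap.ker a).subtype g ∧ IsSuperfluous (LinearMap.ker g) := by
    intro X Y Z _ _ _ _ _ _ a b h hs
    let g : X →ₗ[R] LinearMap.ker b := a.codRestrict _ h.apply_apply_eq_zero
    have hk : LinearMap.ker g = LinearMap.ker a := LinearMap.ker_codRestrict _ _ _
    refine ⟨g, ⟨Submodule.injective_subtype _, ?_, ?_⟩, by rwa [hk]⟩
    · rintro ⟨y, hy⟩
      obtain ⟨x, rfl⟩ := (h y).1 hy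
      exact ⟨x, rfl⟩
    · rw [← hk]
      exact LinearMap.exact_subtype_ker_map g
  match m with
  | 0 => exact ⟨(LinearMap.ker Q.aug).subtype, Q.aug, isSES_ker Q.aug_surjective, Q.minimal_zero⟩
  | 1 => exact ⟨_, key _ _ Q.exact_zero (Q.minimal_succ 0)⟩
  | m + 2 => exact ⟨_, key _ _ (Q.exact_succ m) (Q.minimal_succ (m + 1))⟩

theorem MinProjRes.syzygy_finite [IsNoetherianRing R] {V : Type u} [AddCommGroup V] [Module R V]
    [Module.Finite R V] (Q : MinProjRes (R := R) V) (m : ℕ) : Module.Finite R (Q.syzygy m) := by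
  induction m with
  | zero => assumption
  | succ m ih =>
    obtain ⟨f, g, h, hk⟩ := Q.exists_isSES m
    have := finite_of_isSuperfluous h.surj hk
    exact Module.Finite.of_injective f h.inj

theorem MinProjRes.extZero_syzygy {V W : Type u} [AddCommGroup V] [Module R V] [AddCommGroup W]
    [Module R W] (Q : MinProjRes (R := R) V) (m r : ℕ) (h : ExtZero R V W (m + r + 1)) :
    ExtZero R (Q.syzygy m) W (r + 1) := by
  induction m generalizing r with
  | zero => rwa [Nat.zero_add] at h
  | succ m ih =>
    obtain ⟨f, g, hs, -⟩ := Q.exists_isSES m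
    have := Q.projective m
    refine hs.extZero_left (extZero_of_projective _ _ _) (ih (r + 1) ?_)
    rwa [Nat.add_right_comm m 1 r] at h

end Syzygy

/-! ### Propagation of Ext vanishing to higher degrees -/

section QuasiHereditary

variable {k B : Type u} [Field k] [Ring B] [Algebra k B] {Λ : Type v} [PartialOrder Λ] {e : Λ → B}

/-- Shift down to `Ext^1` along free covers; there the module has a `Δ`-filtration, so all its
higher Ext groups into costandard modules vanish. -/
theorem IsQuasiHereditary.extZero_of_le [IsArtinianRing B] (h : IsQuasiHereditary k e)
    {V : Type u} [AddCommGroup V] [Module B V] [Module.Finite B V] {s : ℕ}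
    (hV : ∀ m, ExtZero B V (Costd k e m) (s + 1)) {r : ℕ} (hr : s ≤ r) (m : Λ) :
    ExtZero B V (Costd k e m) (r + 1) := by
  induction s generalizing V r with
  | zero => exact h.extZero_of_hasStdFiltration r m (h.hasStdFiltration_of_extZero hV)
  | succ s ih =>
    obtain ⟨r, rfl⟩ := Nat.exists_eq_add_of_le' (Nat.lt_of_lt_of_le s.succ_pos hr)
    obtain ⟨n, π, hπ⟩ := Module.Finite.exists_fin' B V
    exact (isSES_ker hπ).extZero_right
      (ih (fun m => (isSES_ker hπ).extZero_left (extZero_of_projective _ _ _) (hV m))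
        (Nat.le_of_succ_le_succ hr)) (extZero_of_projective _ _ _)

end QuasiHereditary

section QKoszulAlgebras

variable {k A : Type u} [Field k] [Ring A] [Algebra k A] {𝒜 : ℕ → Submodule k A}
  [GradedAlgebra 𝒜] {Λ : Type v} [PartialOrder Λ] {e : Λ → GrZero 𝒜}

/-! ### Graded Ext groups over Q-Koszul algebras -/

/-- The Q-Koszul condition in terms of `GrExtVanish`, whose index `i` stands for degree `i + 1`. -/
theorem IsQKoszul.grExtVanish_std {n : ℕ} (h : IsQKoszul 𝒜 e n) (l m : Λ) {i : ℕ} (hi : i + 1 ≤ n)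
    {j : ℤ} (hj : (i : ℤ) + 1 ≠ j) :
    GrExtVanish i (inflateAt 𝒜 (Std e l) 0) (inflateAt 𝒜 (Costd k e m) j) := by
  have h1 : GrExtVanish i (inflate 𝒜 (Std e l)) (inflateAt 𝒜 (Costd k e m) j) := by
    refine GrExtVanish.of_grProjRes fun R => ?_
    by_contra hc
    exact hj (h.ext_concentrated l m (i + 1) j i.succ_pos hi ⟨R, hc⟩)
  refine GrExtVanish.congr_shift (M' := inflateAt 𝒜 (Std e l) 0) (N' := inflateAt 𝒜 (Costd k e m) j)
    0 (LinearEquiv.refl A (inflate 𝒜 (Std e l)).carrier) (fun j x => ?_)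
    (LinearEquiv.refl A _) (fun j x => ?_) h1
  · change x ∈ (inflate 𝒜 (Std e l)).deg j ↔ x ∈ (inflate 𝒜 (Std e l)).deg (j + 0 - 0)
    rw [add_zero, sub_zero]
  · rw [add_zero]; rfl

theorem GrExtVanish.inflate_of_subsingleton {X : Type u} [AddCommGroup X] [Module (GrZero 𝒜) X]
    [Subsingleton X] (s : ℤ) (N : GrMod 𝒜) (i : ℕ) : GrExtVanish i (inflateAt 𝒜 X s) N := by
  have : Subsingleton (inflateAt 𝒜 X s).carrier := (inflateEquiv X s).symm.injective.subsingleton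
  exact GrExtVanish.of_projective inferInstance N i

theorem IsQKoszul.grExtVanish_of_hasStdFiltration {n : ℕ} (h : IsQKoszul 𝒜 e n) {V : Type u}
    [AddCommGroup V] [Module (GrZero 𝒜) V] (hV : HasStdFiltration e V) (m : Λ) {i : ℕ}
    (hi : i + 1 ≤ n) {j : ℤ} (hj : (i : ℤ) + 1 ≠ j) :
    GrExtVanish i (inflateAt 𝒜 V 0) (inflateAt 𝒜 (Costd k e m) j) :=
  HasStdFiltrationOn.induction (e := e) (Γ := Set.univ)
    (p := fun V _ _ => GrExtVanish i (inflateAt 𝒜 V 0) (inflateAt 𝒜 (Costd k e m) j))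
    (fun _ _ _ _ => GrExtVanish.inflate_of_subsingleton _ _ _)
    (fun l _ => h.grExtVanish_std l m hi hj)
    (fun _ _ _ _ _ _ _ _ _ _ _ hs hX hZ => (hs.inflate 0).grExtVanish_mid hX hZ) hV

/-- Vanishing of graded Ext groups for modules with a resolution of length `d` by modules with a
`Δ⁰`-filtration. -/
theorem IsQKoszul.grExtVanish_of_extZero [IsArtinianRing (GrZero 𝒜)] {n : ℕ}
    (h : IsQKoszul 𝒜 e n) (d : ℕ) {V : Type u} [AddCommGroup V] [Module (GrZero 𝒜) V]
    [Module.Finite (GrZero 𝒜) V] (hV : ∀ m, ExtZero (GrZero 𝒜) V (Costd k e m) (d + 1)) (m : Λ)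
    {i : ℕ} (hi : i + 1 ≤ n) {j : ℕ} (hj : j + d < i + 1) :
    GrExtVanish i (inflateAt 𝒜 V 0) (inflateAt 𝒜 (Costd k e m) j) := by
  have hq := h.quasiHereditary
  induction d generalizing V i with
  | zero =>
    exact h.grExtVanish_of_hasStdFiltration (hq.hasStdFiltration_of_extZero hV) m hi (by omega)
  | succ d ih =>
    -- A free cover trades `d + 1` for `d` on its kernel while lowering the degree by one; the free
    -- module itself has a `Δ⁰`-filtration.
    obtain ⟨i, rfl⟩ : ∃ i', i = i' + 1 := ⟨i - 1, by omega⟩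
    obtain ⟨r, π, hπ⟩ := Module.Finite.exists_fin' (GrZero 𝒜) V
    have hs := isSES_ker hπ
    refine (hs.inflate 0).grExtVanish_right (ih (fun m => ?_) (by omega) (by omega)) ?_
    · exact hs.extZero_left (extZero_of_projective _ _ _) (hV m)
    · exact h.grExtVanish_of_hasStdFiltration
        (hq.hasStdFiltration_of_extZero fun m => extZero_of_projective _ _ _) m hi (by omega)

/-! ### The grading of the standard modules -/

theorem GrMod.proj_smul_mem {M : GrMod 𝒜} {S : Submodule A M.carrier} {x : M.carrier}
    (hx : ∀ j, M.proj j x ∈ S) (a : A) (j : ℤ) : M.proj j (a • x) ∈ S := by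
  induction a using DirectSum.Decomposition.inductionOn 𝒜 with
  | zero => rw [zero_smul, map_zero]; exact zero_mem _
  | homogeneous a => rw [M.proj_smul a.2]; exact S.smul_mem _ (hx _)
  | add a b ha hb => rw [add_smul, map_add]; exact add_mem ha hb

theorem GrMod.proj_mem_span {M : GrMod 𝒜} {T : Set M.carrier}
    (hT : ∀ x ∈ T, ∀ j, M.proj j x ∈ Submodule.span A T) {x : M.carrier}
    (hx : x ∈ Submodule.span A T) (j : ℤ) : M.proj j x ∈ Submodule.span A T := by
  induction hx using Submodule.span_induction generalizing j with
  | mem x hx => exact hT x hx j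
  | zero => rw [map_zero]; exact zero_mem _
  | add x y _ _ hx hy => rw [map_add]; exact add_mem (hx j) (hy j)
  | smul a x _ hx => exact GrMod.proj_smul_mem hx a j

/-- The projective module `A e_l` as a graded module. -/
noncomputable def projCoverGr (e : Λ → GrZero 𝒜) (l : Λ) : GrMod 𝒜 :=
  (regular 𝒜).sub (projCover (fun m => (e m : A)) l) fun _ hx j =>
    GrMod.proj_mem_span (M := regular 𝒜) (by
      rintro x rfl j
      have h0 : (e l : A) ∈ (regular 𝒜).deg 0 := (e l).2
      by_cases hj : 0 = j
      · subst hj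
        rw [GrMod.proj_of_mem _ h0]
        exact Submodule.subset_span rfl
      · rw [GrMod.proj_of_mem_ne _ hj h0]
        exact zero_mem _) hx j

/-- The standard module `Δ(l)` as a graded module. -/
noncomputable def stdGr (e : Λ → GrZero 𝒜) (l : Λ) : GrMod 𝒜 :=
  (projCoverGr e l).quot
    (truncKer (fun m => (e m : A)) l (projCover (fun m => (e m : A)) l)) fun _ hx j =>
    GrMod.proj_mem_span (M := projCoverGr e l) (by
      rintro _ ⟨m, hm, y, rfl⟩ j
      refine Submodule.subset_span ⟨m, hm, (projCoverGr e l).proj j y, ?_⟩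
      have := (projCoverGr e l).proj_smul (e m).2 j y
      rwa [Nat.cast_zero, sub_zero] at this) hx j

theorem GrMod.quot_deg_eq_bot {M : GrMod 𝒜} {S : Submodule A M.carrier}
    (hS : ∀ x ∈ S, ∀ j, M.proj j x ∈ S) {j : ℤ} (h : M.deg j = ⊥) : (M.quot S hS).deg j = ⊥ := by
  rw [eq_bot_iff]
  rintro _ ⟨x, hx, rfl⟩
  rw [SetLike.mem_coe, h, AddSubgroup.mem_bot] at hx
  rw [hx]
  exact AddSubgroup.mem_bot.2 (map_zero S.mkQ)

theorem projCoverGr_deg_eq_bot (l : Λ) {j : ℤ} (hj : j < 0) : (projCoverGr e l).deg j = ⊥ := by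
  obtain ⟨i, rfl⟩ := Int.eq_negSucc_of_lt_zero hj
  rw [eq_bot_iff]
  intro x hx
  exact AddSubgroup.mem_bot.2 (Subtype.ext hx)

theorem stdGr_deg_eq_bot (l : Λ) {j : ℤ} (hj : j < 0) : (stdGr e l).deg j = ⊥ :=
  GrMod.quot_deg_eq_bot _ (projCoverGr_deg_eq_bot l hj)

/-- The two descriptions of the grade `s` part of `Δ(l)` agree. -/
noncomputable def stdGradeEquiv (e : Λ → GrZero 𝒜) (l : Λ) (s : ℕ) :
    (stdGr e l).grade s ≃ₗ[GrZero 𝒜] StdGrade 𝒜 e l s :=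
  LinearEquiv.refl (GrZero 𝒜) (StdGrade 𝒜 e l s)

theorem smul_stdGrade_eq_zero {l m : Λ} (hm : ¬ m ≤ l) {s : ℕ} (x : StdGrade 𝒜 e l s) :
    e m • x = 0 :=
  Subtype.ext (smul_std_eq_zero (e := fun m => (e m : A)) hm x.1)

/-- The grade `0` part of `Δ(l)` is `Δ⁰(l)`. -/
theorem nonempty_std_equiv_stdGrade_zero {l : Λ} (hl : e l * e l = e l) :
    Nonempty (Std e l ≃ₗ[GrZero 𝒜] StdGrade 𝒜 e l 0) := by
  let e' : Λ → A := fun m => (e m : A)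
  have hmem : ∀ x : projCover e l, ((x : GrZero 𝒜) : A) ∈ projCover e' l := by
    rintro ⟨x, hx⟩
    obtain ⟨b, rfl⟩ := Submodule.mem_span_singleton.1 hx
    exact Submodule.mem_span_singleton.2 ⟨(b : A), rfl⟩
  let ι : projCover e l →ₗ[GrZero 𝒜] projCover e' l :=
    { toFun := fun x => ⟨_, hmem x⟩
      map_add' := fun _ _ => rfl
      map_smul' := fun _ _ => rfl }
  let ψ₀ : projCover e l →ₗ[GrZero 𝒜] StdGrade 𝒜 e l 0 :=
    { toFun := fun x => ⟨(truncKer e' l (projCover e' l)).mkQ (ι x), ι x, x.1.2, rfl⟩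
      map_add' := fun x y => Subtype.ext (map_add _ (ι x) (ι y))
      map_smul' := fun a x =>
        Subtype.ext (map_smul (truncKer e' l (projCover e' l)).mkQ (a : A) (ι x)) }
  -- Projection to grade `0` maps the truncation kernel of `A e_l` into that of `A_0 e_l`, since it
  -- sends `e_m b e_l` to `e_m π(b) e_l`.
  have hker : ∀ z ∈ truncKer e' l (projCover e' l), ∃ w ∈ truncKer e l (projCover e l),
      projZero 𝒜 (z : A) = (w : GrZero 𝒜) := by
    intro z hz
    induction hz using Submodule.span_induction with
    | mem x hx =>
      obtain ⟨m, hm, ⟨y, hy⟩, rfl⟩ := hx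
      obtain ⟨b, rfl⟩ := Submodule.mem_span_singleton.1 hy
      refine ⟨_, Submodule.subset_span ⟨m, hm, ⟨projZero 𝒜 b • e l,
        Submodule.mem_span_singleton.2 ⟨_, rfl⟩⟩, rfl⟩, ?_⟩
      change projZero 𝒜 ((e m : A) * (b * (e l : A))) = e m * (projZero 𝒜 b * e l)
      rw [map_mul, map_mul, projZero_coe, projZero_coe]
    | zero => exact ⟨0, zero_mem _, map_zero _⟩
    | add x y _ _ hx hy =>
      obtain ⟨a, ha, ha'⟩ := hx
      obtain ⟨b, hb, hb'⟩ := hy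
      exact ⟨a + b, add_mem ha hb, (map_add _ _ _).trans (congrArg₂ _ ha' hb')⟩
    | smul a x _ hx =>
      obtain ⟨w, hw, hw'⟩ := hx
      exact ⟨projZero 𝒜 a • w, Submodule.smul_mem _ _ hw,
        (map_mul _ _ _).trans (congrArg (projZero 𝒜 a * ·) hw')⟩
  have hψ₀ : LinearMap.ker ψ₀ = truncKer e l (projCover e l) := by
    apply le_antisymm
    · intro x hx
      have h1 : (truncKer e' l (projCover e' l)).mkQ (ι x) = 0 := congrArg Subtype.val hx
      rw [Submodule.mkQ_apply, Submodule.Quotient.mk_eq_zero] at h1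
      obtain ⟨w, hw, hw'⟩ := hker _ h1
      have : x = w := Subtype.ext ((projZero_coe x.1).symm.trans hw')
      rwa [this]
    · refine Submodule.span_le.2 ?_
      rintro _ ⟨m, hm, y, rfl⟩
      rw [SetLike.mem_coe, LinearMap.mem_ker, map_smul]
      exact smul_stdGrade_eq_zero hm _
  have hsurj : Function.Surjective ψ₀ := by
    rintro ⟨_, ⟨x, hx⟩, hx0, rfl⟩
    have hxe : x * (e l : A) = x := by
      obtain ⟨b, rfl⟩ := Submodule.mem_span_singleton.1 hx
      change b * (e l : A) * (e l : A) = b * (e l : A)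
      rw [mul_assoc]
      exact congrArg (b * ·) (congrArg Subtype.val hl)
    refine ⟨⟨⟨x, hx0⟩, Submodule.mem_span_singleton.2 ⟨⟨x, hx0⟩, Subtype.ext hxe⟩⟩, rfl⟩
  unfold Std
  rw [← hψ₀]
  exact ⟨ψ₀.quotKerEquivOfSurjective hsurj⟩

end QKoszulAlgebras

section Main

variable {k A : Type u} [Field k] [Ring A] [Algebra k A] {𝒜 : ℕ → Submodule k A}
  [GradedAlgebra 𝒜] {Λ : Type v} [PartialOrder Λ] {e : Λ → GrZero 𝒜}

/-! ### Standard modules of Q-Koszul algebras -/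

theorem isArtinianRing_grZero [Module.Finite k A] : IsArtinianRing (GrZero 𝒜) :=
  IsArtinianRing.of_finite k (GrZero 𝒜)

theorem stdGrade_finite [Module.Finite k A] (l : Λ) (s : ℕ) :
    Module.Finite (GrZero 𝒜) (StdGrade 𝒜 e l s) := by
  have := isArtinianRing_grZero (𝒜 := 𝒜)
  have h1 : Module.Finite (GrZero 𝒜) A := Module.Finite.of_restrictScalars_finite k _ _
  have h2 := std_finite (e := fun m => (e m : A)) l
  have h3 : Module.Finite (GrZero 𝒜) (Std (fun m => (e m : A)) l) := Module.Finite.trans A _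
  infer_instance

theorem smul_inflateAt_eq_zero {X : Type u} [AddCommGroup X] [Module (GrZero 𝒜) X] (s : ℤ)
    {a : GrZero 𝒜} (ha : ∀ x : X, a • x = 0) (x : (inflateAt 𝒜 X s).carrier) : (a : A) • x = 0 := by
  obtain ⟨x, rfl⟩ := (inflateEquiv X s).surjective x
  rw [smul_inflateEquiv, projZero_coe, ha, map_zero]

theorem GrExtVanish.inflateAt_shift {X Y : Type u} [AddCommGroup X] [Module (GrZero 𝒜) X]
    [AddCommGroup Y] [Module (GrZero 𝒜) Y] {i : ℕ} {s t : ℤ}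
    (h : GrExtVanish i (inflateAt 𝒜 X 0) (inflateAt 𝒜 Y (s - t))) :
    GrExtVanish i (inflateAt 𝒜 X t) (inflateAt 𝒜 Y s) := by
  refine GrExtVanish.congr_shift (M' := inflateAt 𝒜 X t) (N' := inflateAt 𝒜 Y s)
    t (LinearEquiv.refl A (inflateAt 𝒜 X 0).carrier) (fun j x => ?_)
    (LinearEquiv.refl A (inflateAt 𝒜 Y (s - t)).carrier) (fun j x => ?_) h
  · change x ∈ (inflate 𝒜 X).deg (j - 0) ↔ x ∈ (inflate 𝒜 X).deg (j + t - t)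
    rw [sub_zero, add_sub_cancel_right]
  · change x ∈ (inflate 𝒜 Y).deg (j - (s - t)) ↔ x ∈ (inflate 𝒜 Y).deg (j + t - s)
    rw [sub_sub_eq_add_sub]

variable [Module.Finite k A]

/-- `Ext^s_{A_0}(Δ(γ)_s, ∇_0(ν)) = 0` if this holds in all smaller positive grades. -/
theorem IsQKoszul.extZero_stdGrade_self (hA : IsQuasiHereditary k (fun l => (e l : A))) {n : ℕ}
    (h : IsQKoszul 𝒜 e (n + 1)) {s : ℕ} (hsn : s + 1 ≤ n) (γ ν : Λ)
    (ih : ∀ t < s, ∀ m, ExtZero (GrZero 𝒜) (StdGrade 𝒜 e γ (t + 1)) (Costd k e m) (t + 1)) :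
    ExtZero (GrZero 𝒜) (StdGrade 𝒜 e γ (s + 1)) (Costd k e ν) (s + 1) := by
  have := isArtinianRing_grZero (𝒜 := 𝒜)
  have hq := h.quasiHereditary
  have hfin := fun t => stdGrade_finite (e := e) γ t
  by_cases hγν : ν < γ
  swap
  -- A weight `l > ν` of `Δ(γ)_{s+1}` would satisfy `l ≤ γ`, forcing `ν < γ`.
  · refine hq.extZero_costd s ν fun l hl x => ?_
    exact smul_stdGrade_eq_zero (fun hc => hγν (hl.trans_le hc)) x
  -- Quasi-heredity of `A` enters here: the inflated `∇_0(ν)` has weights `≤ ν < γ`, so none above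
  -- `γ`.
  have base : GrExtVanish s (stdGr e γ) (inflateAt 𝒜 (Costd k e ν) (s + 1)) := by
    refine GrExtVanish.of_extZero (hA.extZero_std s γ fun m hm x => ?_)
    exact smul_inflateAt_eq_zero _
      (smul_costd_eq_zero fun hc => lt_irrefl _ (hγν.trans (hm.trans_le hc))) x
  -- `X` plays the role of the part of `Δ(γ)` in grades `≥ t`; the grades below `s + 1` are removed
  -- one at a time.
  have trunc : ∀ t : ℕ, t ≤ s + 1 → ∃ X : GrMod 𝒜, (∀ j : ℤ, j < t → X.deg j = ⊥) ∧
      (∀ j : ℕ, t ≤ j → Nonempty (X.grade j ≃ₗ[GrZero 𝒜] StdGrade 𝒜 e γ j)) ∧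
      GrExtVanish s X (inflateAt 𝒜 (Costd k e ν) (s + 1)) := by
    intro t
    induction t with
    | zero => exact fun _ => ⟨_, fun j hj => stdGr_deg_eq_bot γ hj,
        fun j _ => ⟨stdGradeEquiv e γ j⟩, base⟩
    | succ t iht =>
      intro ht
      obtain ⟨X, hX, hXg, hXv⟩ := iht (by omega)
      obtain ⟨K, i, q, hs, hK, hKg⟩ := X.exists_truncation hX
      refine ⟨K, fun j hj => hK j (by exact_mod_cast hj), fun j hj => ?_,
        hs.grExtVanish_left hXv ?_⟩
      · obtain ⟨φ⟩ := hKg j (by exact_mod_cast hj)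
        obtain ⟨ψ⟩ := hXg j (by omega)
        exact ⟨φ.trans ψ⟩
      · obtain ⟨ψ⟩ := hXg t le_rfl
        have : Module.Finite (GrZero 𝒜) (X.grade t) := Module.Finite.equiv ψ.symm
        refine GrExtVanish.inflateAt_shift ?_
        obtain ⟨r, hr⟩ : ∃ r : ℕ, s + 1 = t + r := ⟨s + 1 - t, by omega⟩
        have hcast : ((s : ℤ) + 1 - t) = (r : ℤ) := by
          have : ((s + 1 : ℕ) : ℤ) = ((t + r : ℕ) : ℤ) := congrArg _ hr
          push_cast at this
          omega
        rw [hcast]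
        -- Truncated subtraction is intended: grade `0` is `Δ⁰(γ)`, so grades `0` and `1` both have
        -- resolution length `0`. The target sits in grade `r = s + 1 - t`, with `r + (t - 1) < s +
        -- 2`; the degree used is `s + 2 ≤ n + 1`.
        refine h.grExtVanish_of_extZero (t - 1) (fun m => ?_) ν (by omega) (by omega)
        refine ExtZero.congr_left ψ.symm ?_
        cases t with
        | zero =>
          obtain ⟨φ⟩ := nonempty_std_equiv_stdGrade_zero (e := e) (hq.idem γ)
          exact (hq.extZero_std_costd 0 γ m).congr_left φ
        | succ t => exact ih t (by omega) m
  obtain ⟨X, hX, hXg, hXv⟩ := trunc (s + 1) le_rfl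
  obtain ⟨ψ⟩ := hXg (s + 1) le_rfl
  exact (hXv.extZero_grade (fun j hj => hX j (by exact_mod_cast hj))).congr_left ψ

theorem IsQKoszul.extZero_stdGrade (hA : IsQuasiHereditary k (fun l => (e l : A))) {n : ℕ}
    (h : IsQKoszul 𝒜 e (n + 1)) {s : ℕ} (hs : 0 < s) (hsn : s ≤ n) {r : ℕ} (hr : s ≤ r)
    (γ ν : Λ) : ExtZero (GrZero 𝒜) (StdGrade 𝒜 e γ s) (Costd k e ν) r := by
  have := isArtinianRing_grZero (𝒜 := 𝒜)
  have hfin := stdGrade_finite (e := e) γ s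
  have key : ∀ s : ℕ, s + 1 ≤ n → ∀ ν,
      ExtZero (GrZero 𝒜) (StdGrade 𝒜 e γ (s + 1)) (Costd k e ν) (s + 1) := by
    intro s
    induction s using Nat.strong_induction_on with
    | _ s ih =>
      exact fun hs ν => h.extZero_stdGrade_self hA hs γ ν fun t ht => ih t ht (by omega)
  obtain ⟨s, rfl⟩ := Nat.exists_eq_succ_of_ne_zero hs.ne'
  obtain ⟨r, rfl⟩ := Nat.exists_eq_succ_of_ne_zero (hs.trans_le hr).ne'
  exact h.quasiHereditary.extZero_of_le (key s hsn) (Nat.le_of_succ_le_succ hr) ν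

/-- By dimension shifting, `Ext^1` of the `m`th syzygy into `∇_0(ν)` is controlled by `Ext^{m+1}` of
`Δ(γ)_s`, which vanishes because `m + 1 ≥ s`. -/
theorem IsQKoszul.hasStdFiltration_syzygy (hA : IsQuasiHereditary k (fun l => (e l : A))) {n : ℕ}
    (h : IsQKoszul 𝒜 e (n + 1)) {s : ℕ} (hs : 0 < s) (hsn : s ≤ n) (γ : Λ)
    (Q : MinProjRes (R := GrZero 𝒜) (StdGrade 𝒜 e γ s)) {m : ℕ} (hm : s - 1 ≤ m) :
    HasStdFiltration e (Q.syzygy m) := by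
  have := isArtinianRing_grZero (𝒜 := 𝒜)
  have hfin := stdGrade_finite (e := e) γ s
  have := Q.syzygy_finite m
  exact h.quasiHereditary.hasStdFiltration_of_extZero fun ν =>
    Q.extZero_syzygy m 0 (h.extZero_stdGrade hA hs hsn (by omega) γ ν)

end Main

end QKoszul

theorem mainTheorem12 {k A : Type u} [Field k] [IsAlgClosed k] [Ring A] [Algebra k A]
    [Module.Finite k A] (𝒜 : ℕ → Submodule k A) [GradedAlgebra 𝒜]
    {Λ : Type v} [PartialOrder Λ] (e : Λ → QKoszul.GrZero 𝒜)
    (hA : QKoszul.IsQuasiHereditary k (fun l => (e l : A))) :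
    -- (a) the `2`-Q-Koszul case
    (QKoszul.IsQKoszul 𝒜 e 2 →
      ∀ γ : Λ, QKoszul.HasStdFiltration e (QKoszul.StdGrade 𝒜 e γ 1)) ∧
    -- (b) the `3`-Q-Koszul case
    (QKoszul.IsQKoszul 𝒜 e 3 → ∀ (r : ℕ) (γ ν : Λ), 2 ≤ r →
      Subsingleton (CategoryTheory.Abelian.Ext
        (ModuleCat.of (QKoszul.GrZero 𝒜) (QKoszul.StdGrade 𝒜 e γ 2))
        (ModuleCat.of (QKoszul.GrZero 𝒜) (QKoszul.Costd k e ν)) r)) ∧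
    -- the general case
    (∀ n : ℕ, 0 < n → QKoszul.IsQKoszul 𝒜 e (n + 1) → ∀ s : ℕ, 0 < s → s ≤ n →
      (∀ (r : ℕ) (γ ν : Λ), s ≤ r →
        Subsingleton (CategoryTheory.Abelian.Ext
          (ModuleCat.of (QKoszul.GrZero 𝒜) (QKoszul.StdGrade 𝒜 e γ s))
          (ModuleCat.of (QKoszul.GrZero 𝒜) (QKoszul.Costd k e ν)) r)) ∧
      (∀ (γ : Λ) (Q : QKoszul.MinProjRes (R := QKoszul.GrZero 𝒜) (QKoszul.StdGrade 𝒜 e γ s))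
        (m : ℕ), s - 1 ≤ m → QKoszul.HasStdFiltration e (Q.syzygy m))) := by
  have hart := QKoszul.isArtinianRing_grZero (𝒜 := 𝒜)
  refine ⟨fun h γ => ?_, fun h r γ ν hr => h.extZero_stdGrade hA two_pos le_rfl hr γ ν,
    fun n _ h s hs hsn => ⟨fun r γ ν hr => h.extZero_stdGrade hA hs hsn hr γ ν,
      fun γ Q m hm => h.hasStdFiltration_syzygy hA hs hsn γ Q hm⟩⟩
  have hfin := QKoszul.stdGrade_finite (e := e) γ 1
  -- Part (a) is the case `n = s = r = 1`, combined with the filtration criterion.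
  exact h.quasiHereditary.hasStdFiltration_of_extZero fun ν =>
    h.extZero_stdGrade hA one_pos le_rfl le_rfl γ ν
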